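/- Let $L\ge 1$ be an integer and $\Lambda_L=\{-L,\dots,L\}^2\subset\mathbb Z^2$. Consider the zero-temperature ($\beta=+\infty$) Glauber dynamics of the Ising model in $\Lambda_L$ with "$+$" boundary conditions, started from the all "$-$" configuration: it is the continuous-time Markov chain $(\sigma(t))_{t\ge 0}$ with right-continuous paths on $\{-1,+1\}^{\Lambda_L}$, with $\sigma_x(0)=-1$ for every $x\in\Lambda_L$, in which each site $x\in\Lambda_L$ carries an independent Poisson clock of rate $1$ and, when the clock of $x$ rings, the spin at $x$ is replaced by a sample of its conditional Gibbs measure at $\beta=+\infty$ given the other spins, that is, of the uniform probability measure on the values $s\in\{-1,+1\}$ that minimize $-s\sum_{y\sim x}\sigma_y$; here the sum is over the four nearest neighbours $y$ of $x$ in $\mathbb Z^2$, and $\sigma_y=+1$ for $y\notin\Lambda_L$. (Thus the new spin is that of the majority of the four neighbours, and $\pm1$ with probability $1/2$ each in case of a tie. Equivalently, the generator is $\mathcal L f(\sigma)=\sum_{x\in\Lambda_L}\bigl(\pi_{x,\sigma}(f)-f(\sigma)\bigr)$, where $\pi_{x,\sigma}(f)$ is the average of $f$ after this replacement at $x$.)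 Let $\mathbf P$ be the law of this process and $$\tau_+:=\inf\{t>0:\ \sigma_x(t)=+1\ \text{for every } x\in\Lambda_L\}\in[0,\infty].$$ **Theorem.** There exist constants $c>0$ and $\gamma>0$ (not depending on $L$) such that for every integer $L\ge1$ $$\mathbf P\Bigl(c\,L^2\le\tau_+\le \tfrac1c\,L^2\Bigr)\ \ge\ 1-e^{-\gamma L}.$$ -/

import Mathlib

open Filter Topology MeasureTheory
open scoped NNReal ENNReal

namespace ZeroTempGlauber

noncomputable section

/-- The box `{-L, …, L}²`. -/
def box (L : ℕ) : Finset (ℤ × ℤ) :=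
  Finset.Icc (-(L : ℤ)) L ×ˢ Finset.Icc (-(L : ℤ)) L

/-- The four nearest neighbours of a point of `ℤ²`. -/
def nbrs (x : ℤ × ℤ) : Finset (ℤ × ℤ) :=
  {(x.1 + 1, x.2), (x.1 - 1, x.2), (x.1, x.2 + 1), (x.1, x.2 - 1)}

/-- Spin configurations in the box; the spin space is `ℤˣ = {-1, +1}`. -/
abbrev Config (L : ℕ) : Type := ↥(box L) → ℤˣ

/-- The spin at any point of `ℤ²`, with "plus" boundary conditions outside the box. -/
def spin {L : ℕ} (σ : Config L) (y : ℤ × ℤ) : ℤˣ :=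
  if h : y ∈ box L then σ ⟨y, h⟩ else 1

/-- The Ising energy of a spin `s` at the site `x`, the spins at the other sites being
those of `σ` inside the box and `+1` outside: it is the part of the Hamiltonian
`-∑ σ_x σ_y` (over the bonds `{x, y}` that touch the box) that depends on the spin at `x`. -/
def localEnergy {L : ℕ} (σ : Config L) (x : ↥(box L)) (s : ℤˣ) : ℤ :=
  -∑ y ∈ nbrs x.1, (s : ℤ) * (spin σ y : ℤ)

/-- The spins at `x` that minimize the energy given the spins at the other sites. -/
def groundSpins {L : ℕ} (σ : Config L) (x : ↥(box L)) : Finset ℤˣ :=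
  Finset.univ.filter fun s => ∀ s' : ℤˣ, localEnergy σ x s ≤ localEnergy σ x s'

/-- The conditional Gibbs measure of the spin at `x` given the other spins, at inverse
temperature `β = +∞`: the uniform measure on the minimizers of the energy. -/
def heatBath {L : ℕ} (σ : Config L) (x : ↥(box L)) (s : ℤˣ) : ℝ :=
  if s ∈ groundSpins σ x then ((groundSpins σ x).card : ℝ)⁻¹ else 0

/-- The generator of the dynamics: at each site, at rate one, the spin is replaced by a
sample of its conditional Gibbs measure given the other spins,
`(𝓛 f)(σ) = ∑ₓ (π_{x,σ}(f) - f(σ))`. -/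
def generator (L : ℕ) (f : Config L → ℝ) (σ : Config L) : ℝ :=
  ∑ x : ↥(box L), ((∑ s : ℤˣ, heatBath σ x s * f (Function.update σ x s)) - f σ)

/-- The matrix of the generator (the `Q`-matrix of the chain): the entry `(σ, σ')` is
`(𝓛 1_{σ'})(σ)`. -/
def rateMatrix (L : ℕ) : Matrix (Config L) (Config L) ℝ :=
  Matrix.of fun σ σ' => generator L (Pi.single σ' 1) σ

/-- The transition function `P_t = exp (t 𝓛)`. -/
def transition (L : ℕ) (t : ℝ) : Matrix (Config L) (Config L) ℝ :=
  NormedSpace.exp (t • rateMatrix L)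

/-- `X` is a realization, on the probability space `(Ω, μ)`, of the continuous-time
zero-temperature Glauber dynamics in the box with "plus" boundary conditions and initial
condition `ξ`: it is a Markov process with initial state `ξ` and transition function
`exp (t 𝓛)`, and its paths are almost surely right-continuous (for the discrete topology
on the finite state space). -/
structure IsGlauberDynamics {Ω : Type*} [MeasurableSpace Ω] (μ : Measure Ω) (L : ℕ)
    (ξ : Config L) (X : ℝ≥0 → Ω → Config L) : Prop where
  measurableSet_eq : ∀ (t : ℝ≥0) (σ : Config L), MeasurableSet {ω | X t ω = σ}
  initial : ∀ᵐ ω ∂μ, X 0 ω = ξ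
  right_continuous : ∀ᵐ ω ∂μ, ∀ t : ℝ≥0, ∀ᶠ s in 𝓝[>] t, X s ω = X t ω
  finite_dimensional : ∀ (n : ℕ) (t : ℕ → ℝ≥0) (σ : ℕ → Config L), Monotone t → t 0 = 0 →
    σ 0 = ξ →
    μ.real {ω | ∀ i ≤ n, X (t i) ω = σ i} =
      ∏ i ∈ Finset.range n, transition L ((t (i + 1) : ℝ) - (t i : ℝ)) (σ i) (σ (i + 1))

/-- The first time `inf {t > 0 : X_t ≡ +1}` when all the spins are "plus" (`∞` if there is
no such time). -/
def tauPlus {Ω : Type*} {L : ℕ} (X : ℝ≥0 → Ω → Config L) (ω : Ω) : ℝ≥0∞ :=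
  sInf {a : ℝ≥0∞ | ∃ t : ℝ≥0, 0 < t ∧ (∀ x, X t ω x = 1) ∧ a = (t : ℝ≥0∞)}

end

end ZeroTempGlauber

/-! Both bounds come from an exponential Lyapunov function `f` with `𝓛 f ≤ a f`. Gronwall's
inequality then gives `exp (t𝓛) f ≤ exp (a t) f`, and Markov's inequality bounds the mass of a set
on which `f ≥ 1`.

Upper bound. Replace the minus set by the down-left closed set it generates in the box (`hull`). Its
area decreases when a maximal point flips, at rate at least 1/2, and increases only at a point that
can be added to the staircase, at rate at most 1/2. A staircase has more maximal points than addable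
ones (`card_addables_lt`), so the drift of the area is at most -1/2. The area is at most `(2L+1)²`
and there are `O(L)` active sites. The exponential of `θ` times the area, with `θ` of order `1/L`,
thus decays at a rate of order `1/L`, which beats its initial value `exp (O(L))` after a time of
order `L²`.

Lower bound. Follow the largest orthogonally convex set `B` of 2 × 2 minus blocks with positions in
a cross. Every cell of a minus block has two minus neighbours, so it flips at rate at most 1/2, and
at rate zero unless it sits at an outer corner of `B`. Conversely, a plus site at an inner corner
turns minus at rate at least 1/2 and enlarges `B`. As long as `B` meets all the half arms of the
cross, its outer corner cells exceed its inner ones by at most 8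
(`card_outerCells_le_card_innerCells`), so its area is lost at a bounded average speed. An area of
order `L²` has to be lost before some half arm can be missed; exponential weights with `θ` of order
`1/L` show that this takes a time of order `L²`, up to an exponentially small probability.

Finally the all-plus state is absorbing, so the state at two deterministic times controls the
hitting time (`IsGlauberDynamics.real_tauPlus_ge`). -/

namespace ZeroTempGlauber

/-! ### Gronwall's inequality for matrix exponentials -/

section Semigroup

variable {n : Type*} [Fintype n]

open scoped Matrix

theorem mulVec_mono_of_nonneg {A : Matrix n n ℝ} (hA : ∀ i j, 0 ≤ A i j) {f g : n → ℝ}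
    (h : ∀ i, f i ≤ g i) (i : n) : (A *ᵥ f) i ≤ (A *ᵥ g) i :=
  Finset.sum_le_sum fun j _ => mul_le_mul_of_nonneg_left (h j) (hA i j)

variable [DecidableEq n]

attribute [local instance] Matrix.linftyOpNormedRing Matrix.linftyOpNormedAlgebra in
theorem hasSum_exp_mulVec (A : Matrix n n ℝ) (f : n → ℝ) (i : n) :
    HasSum (fun k : ℕ => (k.factorial : ℝ)⁻¹ * ((A ^ k) *ᵥ f) i)
      ((NormedSpace.exp A *ᵥ f) i) := by
  have h := NormedSpace.exp_series_hasSum_exp' (𝕂 := ℝ) A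
  have h2 : Continuous fun M : Matrix n n ℝ => (M *ᵥ f) i := by fun_prop
  have := h.map (AddMonoidHom.mk' (fun M : Matrix n n ℝ => (M *ᵥ f) i)
    (fun x y => by simp [Matrix.add_mulVec])) h2
  convert this using 1
  · ext k
    simp [Matrix.smul_mulVec]
  · rfl

theorem pow_mulVec_le {A : Matrix n n ℝ} (hA : ∀ i j, 0 ≤ A i j) {f : n → ℝ} {a : ℝ}
    (ha : 0 ≤ a) (hf : ∀ i, (A *ᵥ f) i ≤ a * f i) (k : ℕ) (i : n) :
    ((A ^ k) *ᵥ f) i ≤ a ^ k * f i := by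
  induction k generalizing i with
  | zero => simp
  | succ k ih =>
    rw [pow_succ', ← Matrix.mulVec_mulVec]
    calc (A *ᵥ (A ^ k *ᵥ f)) i ≤ (A *ᵥ (a ^ k • f)) i :=
          mulVec_mono_of_nonneg hA (fun j => by simpa using ih j) i
      _ = a ^ k * (A *ᵥ f) i := by simp [Matrix.mulVec_smul]
      _ ≤ a ^ k * (a * f i) := mul_le_mul_of_nonneg_left (hf i) (pow_nonneg ha k)
      _ = a ^ (k + 1) * f i := by ring

theorem exp_mulVec_le_of_nonneg {A : Matrix n n ℝ} (hA : ∀ i j, 0 ≤ A i j) {f : n → ℝ} {a : ℝ}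
    (ha : 0 ≤ a) (hf : ∀ i, (A *ᵥ f) i ≤ a * f i) (i : n) :
    (NormedSpace.exp A *ᵥ f) i ≤ Real.exp a * f i := by
  have h2 : HasSum (fun k : ℕ => (k.factorial : ℝ)⁻¹ * (a ^ k * f i)) (Real.exp a * f i) := by
    have h3 := NormedSpace.exp_series_hasSum_exp' (𝕂 := ℝ) a
    rw [← Real.exp_eq_exp_ℝ] at h3
    simpa [mul_assoc] using h3.mul_right (f i)
  exact hasSum_le (fun k => mul_le_mul_of_nonneg_left (pow_mulVec_le hA ha hf k i)
    (by positivity)) (hasSum_exp_mulVec A f i) h2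

theorem exp_add_smul_one (A : Matrix n n ℝ) (c : ℝ) :
    NormedSpace.exp (A + c • (1 : Matrix n n ℝ)) = Real.exp c • NormedSpace.exp A := by
  rw [Matrix.exp_add_of_commute _ _ ((Commute.one_right A).smul_right c)]
  have : (c • (1 : Matrix n n ℝ)) = Matrix.diagonal fun _ => c := by
    rw [Matrix.smul_one_eq_diagonal]
  rw [this, Matrix.exp_diagonal]
  have h2 : NormedSpace.exp (fun _ : n => c) = fun _ : n => Real.exp c := by
    ext i
    rw [Pi.coe_exp, Real.exp_eq_exp_ℝ]
  rw [h2, ← Matrix.smul_one_eq_diagonal]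
  simp

/-- Gronwall's inequality for the semigroup of a matrix with nonnegative off-diagonal entries. -/
theorem exp_smul_mulVec_le {A : Matrix n n ℝ} (hA : ∀ i j, i ≠ j → 0 ≤ A i j) {f : n → ℝ}
    {a : ℝ} (hf : ∀ i, (A *ᵥ f) i ≤ a * f i) {t : ℝ} (ht : 0 ≤ t) (i : n) :
    (NormedSpace.exp (t • A) *ᵥ f) i ≤ Real.exp (a * t) * f i := by
  -- Adding `N` times the identity makes all entries and the growth rate nonnegative. The identity
  -- commutes with `A`, so this only multiplies the exponential by a scalar, which cancels at the
  -- end.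
  set N : ℝ := |a| + ∑ j, |A j j| with hN
  have hS : 0 ≤ ∑ j, |A j j| := Finset.sum_nonneg fun _ _ => abs_nonneg _
  set B : Matrix n n ℝ := t • A + (t * N) • (1 : Matrix n n ℝ) with hB
  have hB0 : ∀ i j, 0 ≤ B i j := by
    intro i j
    by_cases hij : i = j
    · subst hij
      have h1 : |A i i| ≤ ∑ j, |A j j| :=
        Finset.single_le_sum (f := fun j => |A j j|) (fun _ _ => abs_nonneg _) (Finset.mem_univ i)
      have h2 : 0 ≤ A i i + N := by
        have := neg_abs_le (A i i)
        have := abs_nonneg a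
        linarith
      simp only [hB, Matrix.add_apply, Matrix.smul_apply, Matrix.one_apply_eq, smul_eq_mul]
      nlinarith [mul_nonneg ht h2]
    · simp only [hB, Matrix.add_apply, Matrix.smul_apply, Matrix.one_apply_ne hij, smul_eq_mul]
      simpa using mul_nonneg ht (hA i j hij)
  have hBf : ∀ i, (B *ᵥ f) i ≤ (a * t + t * N) * f i := by
    intro i
    have h1 : (B *ᵥ f) i = t * (A *ᵥ f) i + t * N * f i := by
      simp [hB, Matrix.add_mulVec, Matrix.smul_mulVec]
    rw [h1]
    nlinarith [mul_le_mul_of_nonneg_left (hf i) ht]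
  have ha : 0 ≤ a * t + t * N := by
    have : 0 ≤ a + N := by
      have := neg_abs_le a
      linarith
    nlinarith [mul_nonneg ht this]
  have key := exp_mulVec_le_of_nonneg hB0 ha hBf i
  rw [hB, exp_add_smul_one, Matrix.smul_mulVec, Real.exp_add] at key
  simp only [Pi.smul_apply, smul_eq_mul] at key
  have hpos := Real.exp_pos (t * N)
  refine le_of_mul_le_mul_left ?_ hpos
  calc _ ≤ _ := key
    _ = _ := by ring

theorem exp_smul_apply_nonneg {A : Matrix n n ℝ} (hA : ∀ i j, i ≠ j → 0 ≤ A i j)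
    {t : ℝ} (ht : 0 ≤ t) (i j : n) : 0 ≤ NormedSpace.exp (t • A) i j := by
  set N : ℝ := ∑ k, |A k k| with hN
  -- Gronwall applied to minus a basis vector: its upper bound is a lower bound on column `j` of the
  -- exponential.
  have hf : ∀ i, (A *ᵥ (-Pi.single j 1)) i ≤ (-N) * (-Pi.single j 1 : n → ℝ) i := by
    intro i
    simp only [Matrix.mulVec_neg, Matrix.mulVec_single_one, Pi.neg_apply, Matrix.col_apply]
    by_cases hij : i = j
    · subst hij
      have h1 : |A i i| ≤ N :=
        Finset.single_le_sum (f := fun j => |A j j|) (fun _ _ => abs_nonneg _) (Finset.mem_univ i)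
      have := neg_abs_le (A i i)
      simp
      linarith
    · have := hA i j hij
      simp [hij]
      linarith
  have h := exp_smul_mulVec_le hA hf ht i
  simp only [Matrix.mulVec_neg, Matrix.mulVec_single_one, Pi.neg_apply, Matrix.col_apply] at h
  have h2 : 0 ≤ Real.exp (-N * t) * (Pi.single j 1 : n → ℝ) i := by
    apply mul_nonneg (Real.exp_pos _).le
    by_cases hij : i = j
    · subst hij; simp
    · simp [hij]
  linarith

end Semigroup

/-! ### Flip rates, the minus set and the generator -/

section HeatBath

variable {L : ℕ}

theorem sum_units_int {M : Type*} [AddCommMonoid M] (f : ℤˣ → M) : ∑ s, f s = f 1 + f (-1) := by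
  have : (Finset.univ : Finset ℤˣ) = {1, -1} := by decide
  rw [this, Finset.sum_pair (by decide)]

theorem sum_nbrs {M : Type*} [AddCommMonoid M] (x : ℤ × ℤ) (f : ℤ × ℤ → M) :
    ∑ y ∈ nbrs x, f y =
      f (x.1 + 1, x.2) + (f (x.1 - 1, x.2) + (f (x.1, x.2 + 1) + f (x.1, x.2 - 1))) := by
  unfold nbrs
  rw [Finset.sum_insert, Finset.sum_insert, Finset.sum_insert, Finset.sum_singleton]
  all_goals simp <;> omega

/-- The sum of the four spins next to `x`. -/
noncomputable def nbrSum (σ : Config L) (x : ℤ × ℤ) : ℤ := ∑ y ∈ nbrs x, (spin σ y : ℤ)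

theorem mem_groundSpins_one (σ : Config L) (x : ↥(box L)) :
    (1 : ℤˣ) ∈ groundSpins σ x ↔ 0 ≤ nbrSum σ x := by
  have h : ∀ s : ℤˣ, localEnergy σ x s = -((s : ℤ) * nbrSum σ x) := by
    intro s; simp [localEnergy, nbrSum, Finset.mul_sum]
  simp only [groundSpins, Finset.mem_filter, Finset.mem_univ, true_and, h]
  constructor
  · intro h; have := h (-1); push_cast at this; omega
  · intro h s; rcases Int.units_eq_one_or s with rfl | rfl <;> push_cast <;> omega

theorem mem_groundSpins_neg_one (σ : Config L) (x : ↥(box L)) :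
    (-1 : ℤˣ) ∈ groundSpins σ x ↔ nbrSum σ x ≤ 0 := by
  have h : ∀ s : ℤˣ, localEnergy σ x s = -((s : ℤ) * nbrSum σ x) := by
    intro s; simp [localEnergy, nbrSum, Finset.mul_sum]
  simp only [groundSpins, Finset.mem_filter, Finset.mem_univ, true_and, h]
  constructor
  · intro h; have := h 1; push_cast at this; omega
  · intro h s; rcases Int.units_eq_one_or s with rfl | rfl <;> push_cast <;> omega

theorem groundSpins_eq (σ : Config L) (x : ↥(box L)) :
    groundSpins σ x = if nbrSum σ x = 0 then {1, -1} else if 0 < nbrSum σ x then {1} else {-1} := by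
  have h1 := mem_groundSpins_one σ x
  have h2 := mem_groundSpins_neg_one σ x
  ext s
  rcases Int.units_eq_one_or s with rfl | rfl
  · rw [h1]; split_ifs <;> simp <;> omega
  · rw [h2]; split_ifs <;> simp <;> omega

theorem heatBath_one (σ : Config L) (x : ↥(box L)) :
    heatBath σ x 1 = if nbrSum σ x = 0 then 1 / 2 else if 0 < nbrSum σ x then 1 else 0 := by
  rw [heatBath, groundSpins_eq]
  have : (1 : ℤˣ) ≠ -1 := by decide
  split_ifs <;> simp_all

theorem heatBath_neg_one (σ : Config L) (x : ↥(box L)) :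
    heatBath σ x (-1) = if nbrSum σ x = 0 then 1 / 2 else if 0 < nbrSum σ x then 0 else 1 := by
  rw [heatBath, groundSpins_eq]
  have : (-1 : ℤˣ) ≠ 1 := by decide
  have : (1 : ℤˣ) ≠ -1 := by decide
  split_ifs <;> simp_all

theorem heatBath_nonneg (σ : Config L) (x : ↥(box L)) (s : ℤˣ) : 0 ≤ heatBath σ x s := by
  unfold heatBath
  split_ifs <;> positivity

theorem sum_heatBath (σ : Config L) (x : ↥(box L)) :
    heatBath σ x 1 + heatBath σ x (-1) = 1 := by
  rw [heatBath_one, heatBath_neg_one]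
  split_ifs <;> norm_num

/-- The set of minus sites. -/
noncomputable def minusSet (σ : Config L) : Finset (ℤ × ℤ) := (box L).filter fun x => spin σ x = -1

theorem mem_minusSet {σ : Config L} {x : ℤ × ℤ} : x ∈ minusSet σ ↔ spin σ x = -1 := by
  unfold minusSet
  rw [Finset.mem_filter, and_iff_right_iff_imp]
  intro h
  by_contra h2
  rw [spin, dif_neg h2] at h
  exact absurd h (by decide)

theorem spin_coe (σ : Config L) (x : ↥(box L)) : spin σ x = σ x := by
  simp [spin]

theorem coe_mem_minusSet {σ : Config L} {x : ↥(box L)} : (x : ℤ × ℤ) ∈ minusSet σ ↔ σ x = -1 := by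
  rw [mem_minusSet, spin_coe]

theorem minusSet_subset (σ : Config L) : minusSet σ ⊆ box L := Finset.filter_subset _ _

theorem spin_eq_ite (σ : Config L) (y : ℤ × ℤ) :
    (spin σ y : ℤ) = if y ∈ minusSet σ then -1 else 1 := by
  rcases Int.units_eq_one_or (spin σ y) with h | h <;> simp [mem_minusSet, h]

theorem nbrSum_eq (σ : Config L) (x : ℤ × ℤ) : nbrSum σ x =
    (if (x.1 + 1, x.2) ∈ minusSet σ then -1 else 1) +
    ((if (x.1 - 1, x.2) ∈ minusSet σ then -1 else 1) +
    ((if (x.1, x.2 + 1) ∈ minusSet σ then -1 else 1) +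
     (if (x.1, x.2 - 1) ∈ minusSet σ then -1 else 1))) := by
  simp only [nbrSum, sum_nbrs, spin_eq_ite]

theorem minusSet_update (σ : Config L) (x : ↥(box L)) (s : ℤˣ) :
    minusSet (Function.update σ x s) =
      if s = -1 then insert (x : ℤ × ℤ) (minusSet σ) else (minusSet σ).erase x := by
  have key : ∀ y : ↥(box L), (y : ℤ × ℤ) ∈ minusSet (Function.update σ x s) ↔
      (y : ℤ × ℤ) ∈ if s = -1 then insert (x : ℤ × ℤ) (minusSet σ) else (minusSet σ).erase x := by
    intro y
    rw [coe_mem_minusSet]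
    by_cases hxy : y = x
    · subst hxy; split_ifs with h <;> simp [h]
    · have : (y : ℤ × ℤ) ≠ x := fun h => hxy (Subtype.ext h)
      rw [Function.update_of_ne hxy]
      split_ifs with h <;> simp [this, coe_mem_minusSet]
  ext y
  by_cases hy : y ∈ box L
  · exact key ⟨y, hy⟩
  · have h1 : y ∉ minusSet (Function.update σ x s) := fun h => hy (minusSet_subset _ h)
    have h2 : y ∉ minusSet σ := fun h => hy (minusSet_subset _ h)
    have h3 : y ≠ x := by rintro rfl; exact hy x.2
    split_ifs <;> simp [h1, h2, h3]

theorem minusSet_eq_empty {σ : Config L} : minusSet σ = ∅ ↔ ∀ x, σ x = 1 := by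
  rw [Finset.eq_empty_iff_forall_notMem]
  constructor
  · intro h x
    have := h x
    rw [coe_mem_minusSet] at this
    exact (Int.units_eq_one_or _).resolve_right this
  · intro h x hx
    have := coe_mem_minusSet.1 (show ((⟨x, minusSet_subset _ hx⟩ : ↥(box L)) : ℤ × ℤ) ∈ _ from hx)
    rw [h] at this
    exact absurd this (by decide)

theorem minusSet_all : minusSet (fun _ => -1 : Config L) = box L := by
  ext x
  simp only [mem_minusSet, spin]
  split_ifs with h <;> simp [h]

/-- The contribution of a minus site to the generator. -/
theorem generator_term_minus (f : Config L → ℝ) (σ : Config L) (x : ↥(box L))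
    (hx : (x : ℤ × ℤ) ∈ minusSet σ) :
    (∑ s : ℤˣ, heatBath σ x s * f (Function.update σ x s)) - f σ =
      heatBath σ x 1 * (f (Function.update σ x 1) - f σ) := by
  have h : Function.update σ x (-1) = σ := by
    rw [← coe_mem_minusSet.1 hx, Function.update_eq_self]
  have := sum_heatBath σ x
  rw [sum_units_int, h]
  linear_combination (f σ) * this

/-- The contribution of a plus site to the generator. -/
theorem generator_term_plus (f : Config L → ℝ) (σ : Config L) (x : ↥(box L))
    (hx : (x : ℤ × ℤ) ∉ minusSet σ) :
    (∑ s : ℤˣ, heatBath σ x s * f (Function.update σ x s)) - f σ =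
      heatBath σ x (-1) * (f (Function.update σ x (-1)) - f σ) := by
  rw [coe_mem_minusSet] at hx
  have h : Function.update σ x 1 = σ := by
    rw [← (Int.units_eq_one_or (σ x)).resolve_right hx, Function.update_eq_self]
  have := sum_heatBath σ x
  rw [sum_units_int, h]
  linear_combination (f σ) * this

theorem sum_jump_single {C X S : Type*} [Fintype C] [DecidableEq C] [Fintype X] [Fintype S]
    (p : X → S → ℝ) (u : X → S → C) (f : C → ℝ) (σ : C) :
    ∑ σ', (∑ x, ((∑ s, p x s * (Pi.single σ' 1 : C → ℝ) (u x s)) -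
      (Pi.single σ' 1 : C → ℝ) σ)) * f σ' = ∑ x, ((∑ s, p x s * f (u x s)) - f σ) := by
  have h : ∀ τ, ∑ σ', (Pi.single σ' 1 : C → ℝ) τ * f σ' = f τ := by
    intro τ
    simp [Pi.single_apply]
  simp_rw [Finset.sum_mul, sub_mul, Finset.sum_mul]
  rw [Finset.sum_comm]
  refine Finset.sum_congr rfl fun x _ => ?_
  rw [Finset.sum_sub_distrib, h, Finset.sum_comm]
  congr 1
  refine Finset.sum_congr rfl fun s _ => ?_
  simp_rw [mul_assoc]
  rw [← Finset.mul_sum, h]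

open scoped Matrix in
theorem rateMatrix_mulVec (f : Config L → ℝ) (σ : Config L) :
    (rateMatrix L *ᵥ f) σ = generator L f σ :=
  sum_jump_single (heatBath σ) (fun x s => Function.update σ x s) f σ

theorem rateMatrix_nonneg (σ σ' : Config L) (h : σ ≠ σ') : 0 ≤ rateMatrix L σ σ' := by
  simp only [rateMatrix, Matrix.of_apply, generator]
  refine Finset.sum_nonneg fun x _ => ?_
  rw [Pi.single_eq_of_ne h, sub_zero]
  refine Finset.sum_nonneg fun s _ => mul_nonneg (heatBath_nonneg _ _ _) ?_
  rw [Pi.single_apply]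
  split_ifs <;> norm_num

open scoped Matrix in
theorem transition_mulVec_le {f : Config L → ℝ} {a : ℝ} (hf : ∀ σ, generator L f σ ≤ a * f σ)
    {t : ℝ} (ht : 0 ≤ t) (σ : Config L) :
    (transition L t *ᵥ f) σ ≤ Real.exp (a * t) * f σ :=
  exp_smul_mulVec_le rateMatrix_nonneg (fun σ => by rw [rateMatrix_mulVec]; exact hf σ) ht σ

theorem transition_nonneg {t : ℝ} (ht : 0 ≤ t) (σ σ' : Config L) : 0 ≤ transition L t σ σ' :=
  exp_smul_apply_nonneg rateMatrix_nonneg ht σ σ'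

/-- Markov's inequality combined with Gronwall: the form in which every Lyapunov function below is
used. -/
theorem sum_transition_le {f : Config L → ℝ} {a : ℝ} (hf : ∀ σ, generator L f σ ≤ a * f σ)
    (hf0 : ∀ σ, 0 ≤ f σ) {S : Finset (Config L)} (hS : ∀ σ ∈ S, 1 ≤ f σ)
    {t : ℝ} (ht : 0 ≤ t) (σ : Config L) :
    ∑ σ' ∈ S, transition L t σ σ' ≤ Real.exp (a * t) * f σ := by
  refine le_trans ?_ (transition_mulVec_le hf ht σ)
  calc ∑ σ' ∈ S, transition L t σ σ' ≤ ∑ σ' ∈ S, transition L t σ σ' * f σ' :=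
        Finset.sum_le_sum fun σ' h => le_mul_of_one_le_right (transition_nonneg ht _ _) (hS _ h)
    _ ≤ ∑ σ', transition L t σ σ' * f σ' :=
        Finset.sum_le_sum_of_subset_of_nonneg (Finset.subset_univ _)
          fun σ' _ _ => mul_nonneg (transition_nonneg ht _ _) (hf0 _)

/-- A site-by-site bound on the generator. -/
theorem generator_le {f : Config L → ℝ} {σ : Config L} (g : ℤ × ℤ → ℝ)
    (hm : ∀ x : ↥(box L), (x : ℤ × ℤ) ∈ minusSet σ →
      heatBath σ x 1 * (f (Function.update σ x 1) - f σ) ≤ g x)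
    (hp : ∀ x : ↥(box L), (x : ℤ × ℤ) ∉ minusSet σ →
      heatBath σ x (-1) * (f (Function.update σ x (-1)) - f σ) ≤ g x) :
    generator L f σ ≤ ∑ x ∈ box L, g x := by
  refine le_trans (Finset.sum_le_sum fun x _ => ?_) (Finset.sum_coe_sort (box L) g).le
  by_cases hx : (x : ℤ × ℤ) ∈ minusSet σ
  · rw [generator_term_minus f σ x hx]; exact hm x hx
  · rw [generator_term_plus f σ x hx]; exact hp x hx

end HeatBath

/-! ### Upper bound: the area of the staircase hull -/

section Hull

variable {L : ℕ}

theorem mem_box {x : ℤ × ℤ} : x ∈ box L ↔ -(L : ℤ) ≤ x.1 ∧ x.1 ≤ L ∧ -(L : ℤ) ≤ x.2 ∧ x.2 ≤ L := by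
  simp only [box, Finset.mem_product, Finset.mem_Icc]; tauto

/-- The smallest subset of the box that contains `M` and, with a point, all the points of the
box that lie below it and to the left. -/
noncomputable def hull (L : ℕ) (M : Finset (ℤ × ℤ)) : Finset (ℤ × ℤ) :=
  (box L).filter fun x => ∃ y ∈ M, x.1 ≤ y.1 ∧ x.2 ≤ y.2

theorem mem_hull {M : Finset (ℤ × ℤ)} {x : ℤ × ℤ} :
    x ∈ hull L M ↔ x ∈ box L ∧ ∃ y ∈ M, x.1 ≤ y.1 ∧ x.2 ≤ y.2 := Finset.mem_filter

theorem hull_mono {M N : Finset (ℤ × ℤ)} (h : M ⊆ N) : hull L M ⊆ hull L N := by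
  intro x hx
  rw [mem_hull] at hx ⊢
  obtain ⟨hb, y, hy, h1⟩ := hx
  exact ⟨hb, y, h hy, h1⟩

theorem subset_hull {M : Finset (ℤ × ℤ)} (h : M ⊆ box L) : M ⊆ hull L M :=
  fun x hx => mem_hull.2 ⟨h hx, x, hx, le_rfl, le_rfl⟩

theorem hull_subset_box (M : Finset (ℤ × ℤ)) : hull L M ⊆ box L := Finset.filter_subset _ _

theorem hull_down {M : Finset (ℤ × ℤ)} {x y : ℤ × ℤ} (hx : x ∈ box L) (hy : y ∈ hull L M)
    (h1 : x.1 ≤ y.1) (h2 : x.2 ≤ y.2) : x ∈ hull L M := by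
  rw [mem_hull] at hy ⊢
  obtain ⟨-, z, hz, h3, h4⟩ := hy
  exact ⟨hx, z, hz, h1.trans h3, h2.trans h4⟩

/-- The maximal points of a set of the form `hull L M`. -/
def maximals (H : Finset (ℤ × ℤ)) : Finset (ℤ × ℤ) :=
  H.filter fun x => (x.1 + 1, x.2) ∉ H ∧ (x.1, x.2 + 1) ∉ H

/-- The points of the box outside a set `H` whose left and lower neighbours are in `H`. -/
noncomputable def addables (L : ℕ) (H : Finset (ℤ × ℤ)) : Finset (ℤ × ℤ) :=
  (box L).filter fun x => x ∉ H ∧ (x.1 - 1, x.2) ∈ H ∧ (x.1, x.2 - 1) ∈ H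

theorem mem_maximals {H : Finset (ℤ × ℤ)} {x : ℤ × ℤ} :
    x ∈ maximals H ↔ x ∈ H ∧ (x.1 + 1, x.2) ∉ H ∧ (x.1, x.2 + 1) ∉ H := Finset.mem_filter

theorem mem_addables {H : Finset (ℤ × ℤ)} {x : ℤ × ℤ} :
    x ∈ addables L H ↔ x ∈ box L ∧ x ∉ H ∧ (x.1 - 1, x.2) ∈ H ∧ (x.1, x.2 - 1) ∈ H :=
  Finset.mem_filter

theorem exists_top {H : Finset (ℤ × ℤ)} {i j : ℤ} (h : (i, j) ∈ H) :
    ∃ j', j ≤ j' ∧ (i, j') ∈ H ∧ ∀ k, (i, k) ∈ H → k ≤ j' := by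
  obtain ⟨x, hx, hmax⟩ := (H.filter fun x => x.1 = i).exists_max_image Prod.snd ⟨(i, j), by simp [h]⟩
  rw [Finset.mem_filter] at hx
  refine ⟨x.2, hmax (i, j) (by simp [h]), ?_, fun k hk => hmax (i, k) (by simp [hk])⟩
  rw [← hx.2]; exact hx.1

/-- Send an addable point to the top of `hull L M` in the column on its left. This top is maximal,
since its right neighbour would force the addable point into the hull. A column contains at most one
addable point, so the map is injective, and it misses the top of the rightmost column. -/
theorem card_addables_lt (M : Finset (ℤ × ℤ)) (hM : (hull L M).Nonempty) :
    (addables L (hull L M)).card + 1 ≤ (maximals (hull L M)).card := by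
  classical
  set H := hull L M with hH
  obtain ⟨p, hp, hpmax⟩ := H.exists_max_image Prod.fst hM
  obtain ⟨J, -, hJ, hJmax⟩ := exists_top (i := p.1) (j := p.2) hp
  have hmem : (p.1, J) ∈ maximals H := by
    rw [mem_maximals]
    refine ⟨hJ, fun h => ?_, fun h => ?_⟩
    · have := hpmax _ h; simp at this
    · have := hJmax _ h; simp at this
  rw [← Finset.card_erase_add_one hmem, Nat.add_le_add_iff_right]
  have htop : ∀ x ∈ addables L H, ∃ j', x.2 ≤ j' ∧ (x.1 - 1, j') ∈ H ∧
      ∀ k, (x.1 - 1, k) ∈ H → k ≤ j' := fun x hx => exists_top (mem_addables.1 hx).2.2.1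
  choose! t ht using htop
  refine Finset.card_le_card_of_injOn (fun x => (x.1 - 1, t x)) ?_ ?_
  · intro x hx
    obtain ⟨h1, h2, h3⟩ := ht x hx
    obtain ⟨hb, hx1, hx2, hx3⟩ := mem_addables.1 hx
    simp only [Finset.coe_erase, Set.mem_sdiff, Finset.mem_coe, Set.mem_singleton_iff,
      Prod.mk.injEq, mem_maximals]
    refine ⟨⟨h2, fun h => ?_, fun h => ?_⟩, fun h => ?_⟩
    · exact hx1 (hull_down hb h (by simp) (by simpa using h1))
    · have := h3 _ h; simp at this
    · have := hpmax _ hx3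
      simp at this; omega
  · intro x hx y hy hxy
    obtain ⟨hb, hx1, hx2, hx3⟩ := mem_addables.1 hx
    obtain ⟨hb', hy1, hy2, hy3⟩ := mem_addables.1 hy
    simp only [Prod.mk.injEq, sub_left_inj] at hxy
    have h2 : x.2 = y.2 := by
      rcases lt_trichotomy x.2 y.2 with h | h | h
      · exact absurd (hull_down hb hy3 (by simp [hxy.1]) (by simp; omega)) hx1
      · exact h
      · exact absurd (hull_down hb' hx3 (by simp [hxy.1]) (by simp; omega)) hy1
    exact Prod.ext hxy.1 h2

/-- There is at most one maximal point per column. -/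
theorem card_maximals_le (M : Finset (ℤ × ℤ)) : (maximals (hull L M)).card ≤ 2 * L + 1 := by
  have : (maximals (hull L M)).card ≤ (Finset.Icc (-(L : ℤ)) L).card := by
    refine Finset.card_le_card_of_injOn Prod.fst ?_ ?_
    · intro x hx
      have := mem_box.1 (hull_subset_box _ (mem_maximals.1 hx).1)
      simp; omega
    · intro x hx y hy hxy
      obtain ⟨hx1, hx2, hx3⟩ := mem_maximals.1 hx
      obtain ⟨hy1, hy2, hy3⟩ := mem_maximals.1 hy
      have hbx := mem_box.1 (hull_subset_box _ hx1)
      have hby := mem_box.1 (hull_subset_box _ hy1)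
      refine Prod.ext hxy ?_
      rcases lt_trichotomy x.2 y.2 with h | h | h
      · exact absurd (hull_down (mem_box.2 (by simp; omega)) hy1 (by simp [hxy]) (by simp; omega)) hx3
      · exact h
      · exact absurd (hull_down (mem_box.2 (by simp; omega)) hx1 (by simp [hxy]) (by simp; omega)) hy3
  refine this.trans ?_
  rw [Int.card_Icc]; omega

theorem hull_erase_subset {M : Finset (ℤ × ℤ)} {x : ℤ × ℤ} (hM : M ⊆ box L)
    (hx : x ∈ maximals (hull L M)) : hull L (M.erase x) ⊆ (hull L M).erase x := by
  intro y hy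
  refine Finset.mem_erase.2 ⟨?_, hull_mono (Finset.erase_subset _ _) hy⟩
  rintro rfl
  obtain ⟨hb, z, hz, h1, h2⟩ := mem_hull.1 hy
  obtain ⟨hne, hz⟩ := Finset.mem_erase.1 hz
  have hzH := subset_hull hM hz
  obtain ⟨hy1, hy2, hy3⟩ := mem_maximals.1 hx
  have hbz := mem_box.1 (hM hz)
  have hby := mem_box.1 hb
  rcases h1.lt_or_eq with h | h
  · exact hy2 (hull_down (mem_box.2 (by simp; omega)) hzH (by simp; omega) h2)
  · rcases h2.lt_or_eq with h' | h'
    · exact hy3 (hull_down (mem_box.2 (by simp; omega)) hzH h1 (by simp; omega))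
    · exact hne (Prod.ext h.symm h'.symm)

theorem maximals_subset {M : Finset (ℤ × ℤ)} (hM : M ⊆ box L) : maximals (hull L M) ⊆ M := by
  intro x hx
  by_contra h
  have := hull_erase_subset hM hx (by rw [Finset.erase_eq_of_notMem h]; exact (mem_maximals.1 hx).1)
  simp at this

theorem hull_insert_subset_of_mem {M : Finset (ℤ × ℤ)} {x : ℤ × ℤ} (hx : x ∈ hull L M) :
    hull L (insert x M) ⊆ hull L M := by
  intro y hy
  obtain ⟨hb, z, hz, h1, h2⟩ := mem_hull.1 hy
  rcases Finset.mem_insert.1 hz with rfl | hz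
  · exact hull_down hb hx h1 h2
  · exact mem_hull.2 ⟨hb, z, hz, h1, h2⟩

theorem hull_insert_subset {M : Finset (ℤ × ℤ)} {x : ℤ × ℤ} (hx : x ∈ addables L (hull L M)) :
    hull L (insert x M) ⊆ insert x (hull L M) := by
  intro y hy
  obtain ⟨hb, z, hz, h1, h2⟩ := mem_hull.1 hy
  obtain ⟨-, -, h3, h4⟩ := mem_addables.1 hx
  rcases Finset.mem_insert.1 hz with rfl | hz
  · rw [Finset.mem_insert]
    rcases h1.lt_or_eq with h | h
    · exact Or.inr (hull_down hb h3 (by simp; omega) h2)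
    · rcases h2.lt_or_eq with h' | h'
      · exact Or.inr (hull_down hb h4 h1 (by simp; omega))
      · exact Or.inl (Prod.ext h h')
  · exact Finset.mem_insert_of_mem (mem_hull.2 ⟨hb, z, hz, h1, h2⟩)

/-- The exponential of the area of the hull of the minus set, set to zero at the
all-plus configuration. -/
noncomputable def hullWeight (θ : ℝ) (σ : Config L) : ℝ :=
  if minusSet σ = ∅ then 0 else Real.exp (θ * (hull L (minusSet σ)).card)

theorem hullWeight_nonneg (θ : ℝ) (σ : Config L) : 0 ≤ hullWeight θ σ := by
  unfold hullWeight; split_ifs <;> positivity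

theorem hullWeight_le {θ : ℝ} (σ : Config L) :
    hullWeight θ σ ≤ Real.exp (θ * (hull L (minusSet σ)).card) := by
  unfold hullWeight; split_ifs <;> [positivity; exact le_rfl]

/-- Maximal points are minus sites whose right and upper neighbours are plus: they flip at rate at
least 1/2 and cost the hull at least one point. Other minus sites can only shrink the hull, and plus
sites inside it do not change it. A plus site outside has plus neighbours above and to the right, so
it flips only if it is addable, at rate 1/2, and adds at most one point. The count of corners
concludes. -/
theorem generator_hullWeight_le {θ : ℝ} (hθ : 0 ≤ θ) (σ : Config L) (hσ : minusSet σ ≠ ∅) :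
    generator L (hullWeight θ) σ ≤
      (1 / 2) * ((Real.exp (-θ) - 1) + 2 * L * (Real.exp θ + Real.exp (-θ) - 2)) *
        hullWeight θ σ := by
  set M := minusSet σ with hM
  set H := hull L M with hH
  have hMb : M ⊆ box L := minusSet_subset σ
  have hv : hullWeight θ σ = Real.exp (θ * H.card) := by
    rw [hullWeight, if_neg hσ]
  set v := Real.exp (θ * H.card) with hvdef
  have hv0 : 0 < v := Real.exp_pos _
  have hem : Real.exp (-θ) ≤ 1 := Real.exp_le_one_iff.2 (by linarith)
  have hep : 1 ≤ Real.exp θ := Real.one_le_exp hθ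
  have hw : ∀ (τ : Config L) (k : ℤ), ((hull L (minusSet τ)).card : ℤ) ≤ H.card + k →
      hullWeight θ τ ≤ v * Real.exp (θ * k) := by
    intro τ k h
    refine (hullWeight_le τ).trans ?_
    rw [hvdef, ← Real.exp_add, Real.exp_le_exp, ← mul_add]
    exact mul_le_mul_of_nonneg_left (by exact_mod_cast h) hθ
  have hbound := generator_le (f := hullWeight θ) (σ := σ)
    (fun x => (if x ∈ maximals H then (1 / 2) * v * (Real.exp (-θ) - 1) else 0) +
      (if x ∈ addables L H then (1 / 2) * v * (Real.exp θ - 1) else 0)) ?_ ?_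
  · rw [Finset.sum_add_distrib, ← Finset.sum_filter, ← Finset.sum_filter,
      Finset.sum_const, Finset.sum_const] at hbound
    have e1 : (box L).filter (· ∈ maximals H) = maximals H := by
      rw [Finset.filter_mem_eq_inter, Finset.inter_eq_right]
      exact (maximals_subset hMb).trans hMb
    have e2 : (box L).filter (· ∈ addables L H) = addables L H := by
      rw [Finset.filter_mem_eq_inter, Finset.inter_eq_right]
      exact Finset.filter_subset _ _
    rw [e1, e2, nsmul_eq_mul, nsmul_eq_mul] at hbound
    refine hbound.trans ?_
    have h1 : ((addables L H).card : ℝ) + 1 ≤ (maximals H).card := by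
      exact_mod_cast card_addables_lt M ((Finset.nonempty_iff_ne_empty.2 hσ).mono (subset_hull hMb))
    have h2 : ((maximals H).card : ℝ) ≤ 2 * L + 1 := by exact_mod_cast card_maximals_le M
    have h3 : 0 ≤ Real.exp θ + Real.exp (-θ) - 2 := by
      have := Real.add_one_le_exp θ
      have := Real.add_one_le_exp (-θ)
      linarith
    rw [hv]
    set r : ℝ := ((maximals H).card : ℝ)
    set a : ℝ := ((addables L H).card : ℝ)
    have key : r * (Real.exp (-θ) - 1) + a * (Real.exp θ - 1) ≤
        (Real.exp (-θ) - 1) + 2 * L * (Real.exp θ + Real.exp (-θ) - 2) := by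
      have h4 : a * (Real.exp θ - 1) ≤ (r - 1) * (Real.exp θ - 1) :=
        mul_le_mul_of_nonneg_right (by linarith) (by linarith)
      have h5 := mul_le_mul_of_nonneg_right (show r - 1 ≤ 2 * L by linarith) h3
      linarith
    have := mul_le_mul_of_nonneg_left key (show 0 ≤ 1 / 2 * v by positivity)
    linarith
  · intro x hx
    have hmono : hullWeight θ (Function.update σ x 1) ≤ v := by
      have := hw (Function.update σ x 1) 0 (by
        rw [minusSet_update, if_neg (by decide), add_zero, Nat.cast_le]
        exact Finset.card_le_card (hull_mono (Finset.erase_subset _ _)))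
      simpa using this
    have hna : (x : ℤ × ℤ) ∉ addables L H :=
      fun h => (mem_addables.1 h).2.1 (subset_hull hMb hx)
    rw [if_neg hna, add_zero, hv]
    split_ifs with hmax
    · have h1 : hullWeight θ (Function.update σ x 1) ≤ v * Real.exp (-θ) := by
        have := hw (Function.update σ x 1) (-1) (by
          rw [minusSet_update, if_neg (by decide), ← hM]
          have h1 := Finset.card_le_card (hull_erase_subset hMb hmax)
          rw [Finset.card_erase_of_mem (mem_maximals.1 hmax).1] at h1
          have h2 : 0 < H.card := Finset.card_pos.2 ⟨_, (mem_maximals.1 hmax).1⟩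
          omega)
        simpa using this
      have h2 : 1 / 2 ≤ heatBath σ x 1 := by
        obtain ⟨-, h2, h3⟩ := mem_maximals.1 hmax
        have h2' := fun h => h2 (subset_hull hMb h)
        have h3' := fun h => h3 (subset_hull hMb h)
        rw [heatBath_one]
        have : 0 ≤ nbrSum σ x := by
          rw [nbrSum_eq, if_neg h2', if_neg h3']; split_ifs <;> norm_num
        split_ifs <;> first | omega | norm_num
      have h3 : hullWeight θ (Function.update σ x 1) - v ≤ v * (Real.exp (-θ) - 1) := by linarith
      have h4 : v * (Real.exp (-θ) - 1) ≤ 0 :=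
        mul_nonpos_of_nonneg_of_nonpos hv0.le (by linarith)
      calc _ ≤ heatBath σ x 1 * (v * (Real.exp (-θ) - 1)) :=
            mul_le_mul_of_nonneg_left h3 (heatBath_nonneg _ _ _)
        _ ≤ 1 / 2 * (v * (Real.exp (-θ) - 1)) := mul_le_mul_of_nonpos_right h2 h4
        _ = _ := by ring
    · exact mul_nonpos_of_nonneg_of_nonpos (heatBath_nonneg _ _ _) (by linarith)
  · intro x hx
    have hnm : (x : ℤ × ℤ) ∉ maximals H := fun h => hx (maximals_subset hMb h)
    rw [if_neg hnm, zero_add, hv]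
    by_cases hxH : (x : ℤ × ℤ) ∈ H
    · rw [if_neg (fun h => (mem_addables.1 h).2.1 hxH)]
      have := hw (Function.update σ x (-1)) 0 (by
        rw [minusSet_update, if_pos rfl, add_zero, Nat.cast_le]
        exact Finset.card_le_card (hull_insert_subset_of_mem hxH))
      exact mul_nonpos_of_nonneg_of_nonpos (heatBath_nonneg _ _ _) (by simpa using this)
    · have hxb := mem_box.1 x.2
      have h1 : ((x : ℤ × ℤ).1 + 1, (x : ℤ × ℤ).2) ∉ M := fun h =>
        hxH (hull_down x.2 (subset_hull hMb h) (by simp) le_rfl)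
      have h2 : ((x : ℤ × ℤ).1, (x : ℤ × ℤ).2 + 1) ∉ M := fun h =>
        hxH (hull_down x.2 (subset_hull hMb h) le_rfl (by simp))
      have hS := nbrSum_eq σ x
      rw [if_neg h1, if_neg h2] at hS
      by_cases h3 : ((x : ℤ × ℤ).1 - 1, (x : ℤ × ℤ).2) ∈ M ∧ ((x : ℤ × ℤ).1, (x : ℤ × ℤ).2 - 1) ∈ M
      · have hadd : (x : ℤ × ℤ) ∈ addables L H := mem_addables.2
          ⟨x.2, hxH, subset_hull hMb h3.1, subset_hull hMb h3.2⟩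
        rw [if_pos hadd]
        rw [if_pos h3.1, if_pos h3.2] at hS
        rw [heatBath_neg_one, if_pos (by rw [hS]; norm_num)]
        have := hw (Function.update σ x (-1)) 1 (by
          rw [minusSet_update, if_pos rfl]
          have h1 := Finset.card_le_card (hull_insert_subset hadd)
          rw [Finset.card_insert_of_notMem hxH] at h1
          exact_mod_cast h1)
        simp only [Int.cast_one, mul_one] at this
        linarith
      · have hpos : 0 < nbrSum σ x := by
          rw [hS]
          split_ifs <;> first | exact absurd ⟨‹_›, ‹_›⟩ h3 | norm_num
        rw [heatBath_neg_one, if_neg hpos.ne', if_pos hpos, zero_mul]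
        split_ifs
        · have : 0 ≤ Real.exp θ - 1 := by linarith
          positivity
        · exact le_rfl

theorem generator_hullWeight_le_neg (hL : 1 ≤ L) (σ : Config L) :
    generator L (hullWeight (1 / (10 * L))) σ ≤ (-(1 / (40 * L))) * hullWeight (1 / (10 * L)) σ := by
  have hL' : (1 : ℝ) ≤ L := by exact_mod_cast hL
  by_cases hσ : minusSet σ = ∅
  · have h0 : hullWeight (1 / (10 * L)) σ = 0 := by rw [hullWeight, if_pos hσ]
    rw [h0, mul_zero]
    refine (generator_le (fun _ => 0) ?_ ?_).trans (by simp)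
    · intro x hx
      rw [hσ] at hx; simp at hx
    · intro x _
      have hpos : 0 < nbrSum σ x := by rw [nbrSum_eq, hσ]; simp
      rw [heatBath_neg_one, if_neg hpos.ne', if_pos hpos, zero_mul]
  · set θ : ℝ := 1 / (10 * L) with hθ
    -- The second-order term is at most `4Lθ² = 0.4 θ` and `exp (-θ) - 1 ≤ -0.9 θ`; half the sum is
    -- at most `-θ/4`.
    have hθ0 : 0 < θ := by positivity
    have hθL : θ * L = 1 / 10 := by rw [hθ]; field_simp
    have hθ1 : θ ≤ 1 / 10 := by nlinarith
    refine (generator_hullWeight_le hθ0.le σ hσ).trans ?_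
    refine mul_le_mul_of_nonneg_right ?_ (hullWeight_nonneg _ _)
    have h1 := Real.abs_exp_sub_one_sub_id_le (x := θ) (by rw [abs_of_pos hθ0]; linarith)
    have h2 := Real.abs_exp_sub_one_sub_id_le (x := -θ) (by rw [abs_neg, abs_of_pos hθ0]; linarith)
    have h3 := (abs_le.1 h1).2
    have h4 := (abs_le.1 h2).2
    have h5 : (1 : ℝ) / (40 * L) = θ / 4 := by rw [hθ]; field_simp; norm_num
    rw [h5]
    have h6 : 2 * (L : ℝ) * (Real.exp θ + Real.exp (-θ) - 2) ≤ 2 * L * (2 * θ ^ 2) :=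
      mul_le_mul_of_nonneg_left (by nlinarith) (by positivity)
    have h7 : 2 * (L : ℝ) * (2 * θ ^ 2) = 4 * (θ * L) * θ := by ring
    rw [hθL] at h7
    nlinarith

theorem card_box (L : ℕ) : (box L).card = (2 * L + 1) ^ 2 := by
  rw [box, Finset.card_product, Int.card_Icc]
  have : ((L : ℤ) + 1 - -(L : ℤ)).toNat = 2 * L + 1 := by omega
  rw [this]; ring

/-- Started from all minus, the dynamics is in the all-plus state at time `120 L²` up to an
exponentially small probability. -/
theorem sum_transition_ne_plus_le (hL : 1 ≤ L) {t : ℝ} (ht : 120 * (L : ℝ) ^ 2 ≤ t) :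
    ∑ σ ∈ Finset.univ.erase (fun _ => 1 : Config L), transition L t (fun _ => -1) σ ≤
      Real.exp (-(2 * L)) := by
  have hL' : (1 : ℝ) ≤ L := by exact_mod_cast hL
  have ht0 : 0 ≤ t := le_trans (by positivity) ht
  refine (sum_transition_le (generator_hullWeight_le_neg hL) (hullWeight_nonneg _) ?_ ht0 _).trans ?_
  · intro σ hσ
    have h : minusSet σ ≠ ∅ := fun h =>
      (Finset.mem_erase.1 hσ).1 (funext (minusSet_eq_empty.1 h))
    rw [hullWeight, if_neg h]
    exact Real.one_le_exp (by positivity)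
  · refine (mul_le_mul_of_nonneg_left (hullWeight_le _) (Real.exp_pos _).le).trans ?_
    rw [← Real.exp_add, Real.exp_le_exp]
    have h1 : ((hull L (minusSet (fun _ => -1 : Config L))).card : ℝ) ≤ (2 * L + 1) ^ 2 := by
      exact_mod_cast (Finset.card_le_card (hull_subset_box _)).trans (card_box L).le
    -- The initial exponent is at most `(2L+1)²/(10L) ≤ L`; the decay over time `120 L²` contributes
    -- `-3L`.
    have h2 : 1 / (10 * (L : ℝ)) * (hull L (minusSet (fun _ => -1 : Config L))).card ≤ L := by
      rw [one_div, inv_mul_le_iff₀ (by positivity)]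
      nlinarith
    have h3 : 3 * (L : ℝ) ≤ 1 / (40 * L) * t := by
      rw [one_div, le_inv_mul_iff₀ (by positivity)]
      nlinarith
    linarith

end Hull

/-! ### Corners of orthogonally convex sets in a cross -/

section Cross

/-- The cross-shaped region `{|x|, |y| ≤ h, min (|x|, |y|) ≤ w}`. -/
noncomputable def cross (w h : ℤ) : Finset (ℤ × ℤ) :=
  (Finset.Icc (-h) h ×ˢ Finset.Icc (-h) h).filter fun p =>
    (-w ≤ p.1 ∧ p.1 ≤ w) ∨ (-w ≤ p.2 ∧ p.2 ≤ w)

theorem mem_cross {w h : ℤ} {p : ℤ × ℤ} : p ∈ cross w h ↔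
    (-h ≤ p.1 ∧ p.1 ≤ h ∧ -h ≤ p.2 ∧ p.2 ≤ h) ∧
      ((-w ≤ p.1 ∧ p.1 ≤ w) ∨ (-w ≤ p.2 ∧ p.2 ≤ w)) := by
  simp only [cross, Finset.mem_filter, Finset.mem_product, Finset.mem_Icc]; tauto

/-- `y` lies in the closed quadrant at `p` in the direction of the signs `s`. -/
def InQuad (s : ℤˣ × ℤˣ) (p y : ℤ × ℤ) : Prop :=
  (s.1 : ℤ) * p.1 ≤ s.1 * y.1 ∧ (s.2 : ℤ) * p.2 ≤ s.2 * y.2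

/-- Every point outside `B` is the corner of a quadrant disjoint from `B`. -/
def OrthoConvex (B : Finset (ℤ × ℤ)) : Prop :=
  ∀ p ∉ B, ∃ s, ∀ y ∈ B, ¬ InQuad s p y

theorem OrthoConvex.cases {B : Finset (ℤ × ℤ)} (hB : OrthoConvex B) {p : ℤ × ℤ} (hp : p ∉ B) :
    (∀ y ∈ B, ¬ (p.1 ≤ y.1 ∧ p.2 ≤ y.2)) ∨ (∀ y ∈ B, ¬ (p.1 ≤ y.1 ∧ y.2 ≤ p.2)) ∨
    (∀ y ∈ B, ¬ (y.1 ≤ p.1 ∧ p.2 ≤ y.2)) ∨ (∀ y ∈ B, ¬ (y.1 ≤ p.1 ∧ y.2 ≤ p.2)) := by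
  obtain ⟨⟨a, b⟩, hs⟩ := hB p hp
  rcases Int.units_eq_one_or a with rfl | rfl <;> rcases Int.units_eq_one_or b with rfl | rfl <;>
    simp [InQuad] at hs <;> simp <;> tauto

/-- The outer corners of `B` in the direction `s`. -/
def outerCorners (s : ℤˣ × ℤˣ) (B : Finset (ℤ × ℤ)) : Finset (ℤ × ℤ) :=
  B.filter fun p => (p.1 + s.1, p.2) ∉ B ∧ (p.1, p.2 + s.2) ∉ B

/-- The inner corners of `B` in the direction `s`, inside `G`. -/
def innerCorners (s : ℤˣ × ℤˣ) (G B : Finset (ℤ × ℤ)) : Finset (ℤ × ℤ) :=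
  (G \ B).filter fun q => (q.1 - s.1, q.2) ∈ B ∧ (q.1, q.2 - s.2) ∈ B

theorem mem_outerCorners {s : ℤˣ × ℤˣ} {B : Finset (ℤ × ℤ)} {p : ℤ × ℤ} :
    p ∈ outerCorners s B ↔ p ∈ B ∧ (p.1 + s.1, p.2) ∉ B ∧ (p.1, p.2 + s.2) ∉ B :=
  Finset.mem_filter

theorem mem_innerCorners {s : ℤˣ × ℤˣ} {G B : Finset (ℤ × ℤ)} {q : ℤ × ℤ} :
    q ∈ innerCorners s G B ↔ q ∈ G ∧ q ∉ B ∧ (q.1 - s.1, q.2) ∈ B ∧ (q.1, q.2 - s.2) ∈ B := by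
  rw [innerCorners, Finset.mem_filter, Finset.mem_sdiff, and_assoc]

/-- `B` meets each half of the four arms of the cross. -/
def MeetsArms (w : ℤ) (B : Finset (ℤ × ℤ)) : Prop :=
  ∀ s : ℤˣ × ℤˣ,
    (∃ y ∈ B, 0 < s.1 * y.1 ∧ s.1 * y.1 ≤ w ∧ w < s.2 * y.2) ∧
    (∃ y ∈ B, w < s.1 * y.1 ∧ 0 < s.2 * y.2 ∧ s.2 * y.2 ≤ w)

/-- Each half arm contains a rectangle of `w * (h - w)` points of the cross, too many for all of
them to be missing from `B`. -/
theorem meetsArms_of_card {w h : ℤ} {B : Finset (ℤ × ℤ)} (hw : 0 ≤ w) (hwh : w ≤ h)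
    (hB : ((cross w h \ B).card : ℤ) < w * (h - w)) : MeetsArms w B := by
  have key : ∀ f : ℤ × ℤ → ℤ × ℤ, Function.Injective f →
      (∀ p ∈ Finset.Ioc 0 w ×ˢ Finset.Ioc w h, f p ∈ cross w h) →
      ∃ p ∈ Finset.Ioc 0 w ×ˢ Finset.Ioc w h, f p ∈ B := by
    intro f hf hG
    by_contra hcon
    push Not at hcon
    have h1 := Finset.card_le_card_of_injOn (s := Finset.Ioc 0 w ×ˢ Finset.Ioc w h)
      (t := cross w h \ B) f (fun p hp => by
        rw [Finset.mem_coe, Finset.mem_sdiff]; exact ⟨hG p hp, hcon p hp⟩) hf.injOn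
    rw [Finset.card_product, Int.card_Ioc, Int.card_Ioc] at h1
    have h2 : ((w - 0).toNat * (h - w).toNat : ℤ) ≤ (cross w h \ B).card := by exact_mod_cast h1
    rw [Int.toNat_of_nonneg (by omega), Int.toNat_of_nonneg (by omega), sub_zero] at h2
    omega
  rintro ⟨a, b⟩
  constructor
  · obtain ⟨p, hp, hpB⟩ := key (fun p => (a * p.1, b * p.2)) (by
      intro p q hpq
      rcases Int.units_eq_one_or a with rfl | rfl <;>
        rcases Int.units_eq_one_or b with rfl | rfl <;> simpa [Prod.ext_iff] using hpq) (by
      intro p hp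
      simp only [Finset.mem_product, Finset.mem_Ioc] at hp
      rcases Int.units_eq_one_or a with rfl | rfl <;>
        rcases Int.units_eq_one_or b with rfl | rfl <;> simp [mem_cross] <;> omega)
    simp only [Finset.mem_product, Finset.mem_Ioc] at hp
    refine ⟨_, hpB, ?_⟩
    rcases Int.units_eq_one_or a with rfl | rfl <;>
      rcases Int.units_eq_one_or b with rfl | rfl <;> simp <;> omega
  · obtain ⟨p, hp, hpB⟩ := key (fun p => (a * p.2, b * p.1)) (by
      intro p q hpq
      rcases Int.units_eq_one_or a with rfl | rfl <;>
        rcases Int.units_eq_one_or b with rfl | rfl <;>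
          simp [Prod.ext_iff] at hpq ⊢ <;> tauto) (by
      intro p hp
      simp only [Finset.mem_product, Finset.mem_Ioc] at hp
      rcases Int.units_eq_one_or a with rfl | rfl <;>
        rcases Int.units_eq_one_or b with rfl | rfl <;> simp [mem_cross] <;> omega)
    simp only [Finset.mem_product, Finset.mem_Ioc] at hp
    refine ⟨_, hpB, ?_⟩
    rcases Int.units_eq_one_or a with rfl | rfl <;>
      rcases Int.units_eq_one_or b with rfl | rfl <;> simp <;> omega

/-- The reflection with signs `s`. -/
def reflect (s : ℤˣ × ℤˣ) : ℤ × ℤ ≃ ℤ × ℤ where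
  toFun p := (s.1 * p.1, s.2 * p.2)
  invFun p := (s.1 * p.1, s.2 * p.2)
  left_inv p := by simp [← mul_assoc, ← Units.val_mul]
  right_inv p := by simp [← mul_assoc, ← Units.val_mul]

theorem reflect_apply (s : ℤˣ × ℤˣ) (p : ℤ × ℤ) : reflect s p = (s.1 * p.1, s.2 * p.2) := rfl

theorem reflect_reflect (s : ℤˣ × ℤˣ) (p : ℤ × ℤ) : reflect s (reflect s p) = p :=
  (reflect s).left_inv p

theorem mem_map_reflect {s : ℤˣ × ℤˣ} {B : Finset (ℤ × ℤ)} {p : ℤ × ℤ} :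
    p ∈ B.map (reflect s).toEmbedding ↔ reflect s p ∈ B := by
  rw [Finset.mem_map_equiv]; rfl

theorem inQuad_reflect {s u : ℤˣ × ℤˣ} {p y : ℤ × ℤ} :
    InQuad s (reflect u p) (reflect u y) ↔ InQuad (s * u) p y := by
  simp [InQuad, reflect_apply, mul_assoc]

theorem OrthoConvex.map_reflect {B : Finset (ℤ × ℤ)} (hB : OrthoConvex B) (u : ℤˣ × ℤˣ) :
    OrthoConvex (B.map (reflect u).toEmbedding) := by
  intro p hp
  rw [mem_map_reflect] at hp
  obtain ⟨s, hs⟩ := hB _ hp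
  refine ⟨s * u, fun y hy h => hs _ (mem_map_reflect.1 hy) (inQuad_reflect.2 h)⟩

theorem MeetsArms.map_reflect {w : ℤ} {B : Finset (ℤ × ℤ)} (hB : MeetsArms w B) (u : ℤˣ × ℤˣ) :
    MeetsArms w (B.map (reflect u).toEmbedding) := by
  intro s
  obtain ⟨⟨y, hy, h⟩, ⟨z, hz, h'⟩⟩ := hB (s * u)
  refine ⟨⟨reflect u y, ?_, ?_⟩, ⟨reflect u z, ?_, ?_⟩⟩
  · rwa [mem_map_reflect, reflect_reflect]
  · simpa [reflect_apply, mul_assoc] using h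
  · rwa [mem_map_reflect, reflect_reflect]
  · simpa [reflect_apply, mul_assoc] using h'

theorem map_reflect_cross {w h : ℤ} (u : ℤˣ × ℤˣ) :
    (cross w h).map (reflect u).toEmbedding = cross w h := by
  obtain ⟨a, b⟩ := u
  ext p
  rw [mem_map_reflect, mem_cross, mem_cross]
  rcases Int.units_eq_one_or a with rfl | rfl <;>
    rcases Int.units_eq_one_or b with rfl | rfl <;> simp [reflect_apply] <;> omega

theorem outerCorners_map_reflect (s : ℤˣ × ℤˣ) (B : Finset (ℤ × ℤ)) :
    outerCorners (1, 1) (B.map (reflect s).toEmbedding) =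
      (outerCorners s B).map (reflect s).toEmbedding := by
  ext p
  simp only [mem_outerCorners, mem_map_reflect, reflect_apply]
  simp [mul_add]

theorem innerCorners_map_reflect (s : ℤˣ × ℤˣ) (G B : Finset (ℤ × ℤ)) :
    innerCorners (1, 1) (G.map (reflect s).toEmbedding) (B.map (reflect s).toEmbedding) =
      (innerCorners s G B).map (reflect s).toEmbedding := by
  ext p
  simp only [mem_innerCorners, mem_map_reflect, reflect_apply]
  simp [mul_sub]

variable {w h : ℤ} {B : Finset (ℤ × ℤ)}

/-- Two opposite regions at a point of the cross cannot both be disjoint from `B`. -/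
theorem MeetsArms.exists_southeast_or_northwest (hB : MeetsArms w B) {p : ℤ × ℤ}
    (hp : p ∈ cross w h) :
    ∃ y ∈ B, (p.1 + 1 ≤ y.1 ∧ y.2 ≤ p.2) ∨ (y.1 ≤ p.1 ∧ p.2 + 1 ≤ y.2) := by
  rw [mem_cross] at hp
  obtain ⟨-, hp⟩ := hp
  by_cases h1 : p.1 ≤ w
  · by_cases h2 : 0 ≤ p.2
    · obtain ⟨y, hy, h3⟩ := (hB (1, -1)).2
      simp at h3
      exact ⟨y, hy, by omega⟩
    · by_cases h4 : 0 ≤ p.1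
      · obtain ⟨y, hy, h3⟩ := (hB (-1, 1)).1
        simp at h3
        exact ⟨y, hy, by omega⟩
      · by_cases h5 : -w ≤ p.1
        · obtain ⟨y, hy, h3⟩ := (hB (-1, 1)).2
          simp at h3
          exact ⟨y, hy, by omega⟩
        · obtain ⟨y, hy, h3⟩ := (hB (1, -1)).1
          simp at h3
          exact ⟨y, hy, by omega⟩
  · obtain ⟨y, hy, h3⟩ := (hB (1, 1)).1
    simp at h3
    exact ⟨y, hy, by omega⟩

theorem MeetsArms.exists_northeast_or_southwest (hB : MeetsArms w B) {z : ℤ × ℤ}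
    (h1 : ¬ (z.1 < -w ∧ w < z.2)) (h2 : ¬ (w < z.1 ∧ z.2 < -w)) :
    ∃ y ∈ B, (z.1 < y.1 ∧ z.2 < y.2) ∨ (y.1 < z.1 ∧ y.2 < z.2) := by
  by_cases h3 : z.1 ≤ 0 ∧ z.2 ≤ w
  · obtain ⟨y, hy, h⟩ := (hB (1, 1)).1
    simp at h
    exact ⟨y, hy, by omega⟩
  by_cases h4 : z.2 ≤ 0 ∧ z.1 ≤ w
  · obtain ⟨y, hy, h⟩ := (hB (1, 1)).2
    simp at h
    exact ⟨y, hy, by omega⟩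
  by_cases h5 : 0 ≤ z.1 ∧ -w ≤ z.2
  · obtain ⟨y, hy, h⟩ := (hB (-1, -1)).1
    simp at h
    exact ⟨y, hy, by omega⟩
  · obtain ⟨y, hy, h⟩ := (hB (-1, -1)).2
    simp at h
    exact ⟨y, hy, by omega⟩

/-- This excludes pinching at a diagonal contact. The right and upper neighbours of `p` are corners
of empty quadrants. These cannot contain `p`, so they open to the east and to the north
respectively. If either is the northeast quadrant, a point `y ≠ p` northeast of `p` lies in one of
the two. In the remaining case southeast and northwest are both empty, which the arms forbid. -/
theorem eq_of_mem_outerCorners_northeast (hoc : OrthoConvex B) (hm : MeetsArms w B)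
    (hG : B ⊆ cross w h) {p : ℤ × ℤ} (hp : p ∈ outerCorners (1, 1) B) {y : ℤ × ℤ} (hy : y ∈ B)
    (h1 : p.1 ≤ y.1) (h2 : p.2 ≤ y.2) : y = p := by
  rw [mem_outerCorners] at hp
  obtain ⟨hpB, hr, hu⟩ := hp
  simp only [Units.val_one] at hr hu
  obtain ⟨z, hz, hz'⟩ := hm.exists_southeast_or_northwest (hG hpB)
  have hr1 := hoc.cases hr
  have hu1 := hoc.cases hu
  have key : ¬ (p.1 + 1 ≤ y.1 ∨ p.2 + 1 ≤ y.2) := by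
    intro hcon
    rcases hr1 with e | e | e | e
    · rcases hu1 with e' | e' | e' | e'
      · have := e y hy; have := e' y hy; simp at *; omega
      · have := e' p hpB; simp at this
      · have := e y hy; have := e' y hy; simp at *; omega
      · have := e' p hpB; simp at this
    · rcases hu1 with e' | e' | e' | e'
      · have := e y hy; have := e' y hy; simp at *; omega
      · have := e' p hpB; simp at this
      · have := e z hz; have := e' z hz; simp at *; omega
      · have := e' p hpB; simp at this
    · have := e p hpB; simp at this
    · have := e p hpB; simp at this
  exact Prod.ext (by omega) (by omega)

/-- Along the northeast boundary an inner corner follows each outer corner except the rightmost. The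
inner corner is lost if it falls on the reentrant corner `(w + 1, w + 1)` of the cross, outside the
region. These two exceptions account for the constant 2. -/
theorem card_outerCorners_northeast_le (hoc : OrthoConvex B) (hm : MeetsArms w B)
    (hG : B ⊆ cross w h) :
    (outerCorners (1, 1) B).card ≤ (innerCorners (1, 1) (cross w h) B).card + 2 := by
  classical
  rw [← Finset.card_filter_add_card_filter_not (s := outerCorners (1, 1) B)
    (fun p => ∃ y ∈ B, p.1 < y.1)]
  have hlast : ((outerCorners (1, 1) B).filter fun p => ¬ ∃ y ∈ B, p.1 < y.1).card ≤ 1 := by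
    rw [Finset.card_le_one]
    intro p hp q hq
    rw [Finset.mem_filter] at hp hq
    have hpB := (mem_outerCorners.1 hp.1).1
    have hqB := (mem_outerCorners.1 hq.1).1
    have h1 : p.1 = q.1 := by
      have h1 : ¬ p.1 < q.1 := fun h => hp.2 ⟨q, hqB, h⟩
      have h2 : ¬ q.1 < p.1 := fun h => hq.2 ⟨p, hpB, h⟩
      omega
    rcases le_total p.2 q.2 with h2 | h2
    · exact (eq_of_mem_outerCorners_northeast hoc hm hG hp.1 hqB h1.le h2).symm
    · exact eq_of_mem_outerCorners_northeast hoc hm hG hq.1 hpB h1.ge h2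
  have htop : ∀ p ∈ (outerCorners (1, 1) B).filter (fun p => ∃ y ∈ B, p.1 < y.1),
      ∃ z ∈ B, p.1 < z.1 ∧ ∀ y ∈ B, p.1 < y.1 → y.2 ≤ z.2 := by
    intro p hp
    obtain ⟨-, y, hy, hpy⟩ := Finset.mem_filter.1 hp
    obtain ⟨z, hz, hzmax⟩ := (B.filter fun y => p.1 < y.1).exists_max_image Prod.snd
      ⟨y, by simp [hy, hpy]⟩
    rw [Finset.mem_filter] at hz
    exact ⟨z, hz.1, hz.2, fun y hy h => hzmax y (by simp [hy, h])⟩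
  choose! t ht htp htmax using htop
  have hmain : ((outerCorners (1, 1) B).filter fun p => ∃ y ∈ B, p.1 < y.1).card ≤
      (insert (w + 1, w + 1) (innerCorners (1, 1) (cross w h) B)).card := by
    -- With `t p` a highest point of `B` strictly to the right of `p`, the boundary steps down from
    -- `p` to the height of `t p`, and the inner corner sits there, in the column after `p`.
    refine Finset.card_le_card_of_injOn (fun p => (p.1 + 1, (t p).2 + 1)) ?_ ?_
    · intro p hp
      have hz := ht p hp
      have hpz := htp p hp
      have hmax := htmax p hp
      set z := t p
      have hpo := (Finset.mem_filter.1 hp).1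
      have hpB := (mem_outerCorners.1 hpo).1
      have hlt : z.2 < p.2 := by
        by_contra hcon
        have := eq_of_mem_outerCorners_northeast hoc hm hG hpo hz hpz.le (not_lt.1 hcon)
        rw [this] at hpz
        exact lt_irrefl _ hpz
      have hpG := mem_cross.1 (hG hpB)
      have hzG := mem_cross.1 (hG hz)
      have hNE : ∀ y ∈ B, ¬ (p.1 + 1 ≤ y.1 ∧ z.2 + 1 ≤ y.2) := by
        intro y hy h
        have := hmax y hy (by omega)
        omega
      have hright : (p.1 + 1, z.2) ∈ B := by
        by_contra hcon
        obtain ⟨y, hy, hy'⟩ := hm.exists_northeast_or_southwest (z := (p.1 + 1, z.2))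
          (by simp; omega) (by simp; omega)
        have hN := hNE y hy
        -- Three of the quadrants contain `z` or `p`. The last one is excluded by a point given by
        -- the arms, which cannot lie to the northeast since `z` is highest.
        rcases hoc.cases hcon with e | e | e | e
        · have := e z hz; simp at this; omega
        · have := e z hz; simp at this; omega
        · have := e p hpB; simp at this; omega
        · have := e y hy; simp at this hy'; omega
      have hup : (p.1, z.2 + 1) ∈ B := by
        by_contra hcon
        obtain ⟨y, hy, hy'⟩ := hm.exists_northeast_or_southwest (z := (p.1, z.2 + 1))
          (by simp; omega) (by simp; omega)
        have hN := hNE y hy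
        rcases hoc.cases hcon with e | e | e | e
        · have := e p hpB; simp at this; omega
        · have := e z hz; simp at this; omega
        · have := e p hpB; simp at this; omega
        · have := e y hy; simp at this hy'; omega
      change (p.1 + 1, z.2 + 1) ∈ (insert _ _ : Finset (ℤ × ℤ))
      rw [Finset.mem_insert, mem_innerCorners]
      have hrG := mem_cross.1 (hG hright)
      have huG := mem_cross.1 (hG hup)
      simp only at hrG huG
      by_cases hc : p.1 + 1 = w + 1 ∧ z.2 + 1 = w + 1
      · exact Or.inl (Prod.ext hc.1 hc.2)
      · refine Or.inr ⟨?_, fun h => hNE _ h ⟨le_rfl, le_rfl⟩, by simpa using hup,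
          by simpa using hright⟩
        rw [mem_cross]
        simp only
        omega
    · intro p hp q hq hpq
      simp only [Prod.mk.injEq, add_left_inj] at hpq
      have hpo := (Finset.mem_filter.1 hp).1
      have hqo := (Finset.mem_filter.1 hq).1
      rcases le_total p.2 q.2 with h2 | h2
      · exact (eq_of_mem_outerCorners_northeast hoc hm hG hpo (mem_outerCorners.1 hqo).1
          hpq.1.le h2).symm
      · exact eq_of_mem_outerCorners_northeast hoc hm hG hqo (mem_outerCorners.1 hpo).1 hpq.1.ge h2
  have := Finset.card_insert_le (w + 1, w + 1) (innerCorners (1, 1) (cross w h) B)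
  omega

theorem card_outerCorners_northeast_le_width (hoc : OrthoConvex B) (hm : MeetsArms w B)
    (hG : B ⊆ cross w h) (hh : 0 ≤ h) :
    ((outerCorners (1, 1) B).card : ℤ) ≤ 2 * h + 1 := by
  have : (outerCorners (1, 1) B).card ≤ (Finset.Icc (-h) h).card := by
    refine Finset.card_le_card_of_injOn Prod.fst ?_ ?_
    · intro p hp
      have := mem_cross.1 (hG (mem_outerCorners.1 hp).1)
      simp; omega
    · intro p hp q hq hpq
      rcases le_total p.2 q.2 with h2 | h2
      · exact (eq_of_mem_outerCorners_northeast hoc hm hG hp (mem_outerCorners.1 hq).1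
          hpq.le h2).symm
      · exact eq_of_mem_outerCorners_northeast hoc hm hG hq (mem_outerCorners.1 hp).1 hpq.ge h2
  rw [Int.card_Icc] at this
  omega

theorem map_reflect_subset_cross (hG : B ⊆ cross w h) (s : ℤˣ × ℤˣ) :
    B.map (reflect s).toEmbedding ⊆ cross w h := by
  rw [← map_reflect_cross s]
  exact Finset.map_subset_map.2 hG

theorem card_outerCorners_le (hoc : OrthoConvex B) (hm : MeetsArms w B)
    (hG : B ⊆ cross w h) (s : ℤˣ × ℤˣ) :
    (outerCorners s B).card ≤ (innerCorners s (cross w h) B).card + 2 := by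
  have := card_outerCorners_northeast_le (hoc.map_reflect s) (hm.map_reflect s)
    (map_reflect_subset_cross hG s)
  rwa [← map_reflect_cross s, innerCorners_map_reflect, outerCorners_map_reflect,
    Finset.card_map, Finset.card_map] at this

theorem card_outerCorners_le_width (hoc : OrthoConvex B) (hm : MeetsArms w B)
    (hG : B ⊆ cross w h) (hh : 0 ≤ h) (s : ℤˣ × ℤˣ) :
    ((outerCorners s B).card : ℤ) ≤ 2 * h + 1 := by
  have := card_outerCorners_northeast_le_width (hoc.map_reflect s) (hm.map_reflect s)
    (map_reflect_subset_cross hG s) hh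
  rwa [outerCorners_map_reflect, Finset.card_map] at this

theorem eq_of_mem_outerCorners (hoc : OrthoConvex B) (hm : MeetsArms w B)
    (hG : B ⊆ cross w h) {s : ℤˣ × ℤˣ} {p : ℤ × ℤ} (hp : p ∈ outerCorners s B) {y : ℤ × ℤ}
    (hy : y ∈ B) (hq : InQuad s p y) : y = p := by
  apply (reflect s).injective
  refine eq_of_mem_outerCorners_northeast (hoc.map_reflect s) (hm.map_reflect s)
    (map_reflect_subset_cross hG s) ?_ ?_ hq.1 hq.2
  · rwa [outerCorners_map_reflect, Finset.mem_map_equiv, Equiv.symm_apply_apply]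
  · rwa [mem_map_reflect, reflect_reflect]

theorem OrthoConvex.erase (hoc : OrthoConvex B) (hm : MeetsArms w B)
    (hG : B ⊆ cross w h) {s : ℤˣ × ℤˣ} {p : ℤ × ℤ} (hp : p ∈ outerCorners s B) :
    OrthoConvex (B.erase p) := by
  intro p' hp'
  by_cases hpp : p' = p
  · subst hpp
    refine ⟨s, fun y hy hq => (Finset.mem_erase.1 hy).1 ?_⟩
    exact eq_of_mem_outerCorners hoc hm hG hp (Finset.mem_erase.1 hy).2 hq
  · obtain ⟨s', hs'⟩ := hoc p' fun h => hp' (Finset.mem_erase.2 ⟨hpp, h⟩)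
    exact ⟨s', fun y hy => hs' y (Finset.mem_erase.1 hy).2⟩

/-- A quadrant that contains `q` but neither of its two neighbours in `B` must have its corner at
`q`. Hence the empty quadrants at the other points stay empty. -/
theorem OrthoConvex.insert (hoc : OrthoConvex B) {G : Finset (ℤ × ℤ)} {s : ℤˣ × ℤˣ} {q : ℤ × ℤ}
    (hq : q ∈ innerCorners s G B) : OrthoConvex (insert q B) := by
  obtain ⟨-, -, h1, h2⟩ := mem_innerCorners.1 hq
  intro p hp
  rw [Finset.mem_insert, not_or] at hp
  obtain ⟨s', hs'⟩ := hoc p hp.2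
  refine ⟨s', fun y hy hyq => ?_⟩
  rcases Finset.mem_insert.1 hy with rfl | hy
  · apply hp.1
    have e1 := hs' _ h1
    have e2 := hs' _ h2
    obtain ⟨a, b⟩ := s
    obtain ⟨a', b'⟩ := s'
    rcases Int.units_eq_one_or a with rfl | rfl <;> rcases Int.units_eq_one_or b with rfl | rfl <;>
    rcases Int.units_eq_one_or a' with rfl | rfl <;>
    rcases Int.units_eq_one_or b' with rfl | rfl <;>
    · simp [InQuad] at e1 e2 hyq
      exact Prod.ext (by omega) (by omega)
  · exact hs' y hy hyq

theorem not_inQuad_of_mem_innerCorners (hoc : OrthoConvex B) {G : Finset (ℤ × ℤ)}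
    {s : ℤˣ × ℤˣ} {q : ℤ × ℤ} (hq : q ∈ innerCorners s G B) {y : ℤ × ℤ} (hy : y ∈ B) :
    ¬ InQuad s q y := by
  obtain ⟨-, h0, h1, h2⟩ := mem_innerCorners.1 hq
  obtain ⟨s', hs'⟩ := hoc q h0
  have e1 := hs' _ h1
  have e2 := hs' _ h2
  have e3 := hs' _ hy
  obtain ⟨a, b⟩ := s
  obtain ⟨a', b'⟩ := s'
  rcases Int.units_eq_one_or a with rfl | rfl <;> rcases Int.units_eq_one_or b with rfl | rfl <;>
  rcases Int.units_eq_one_or a' with rfl | rfl <;>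
  rcases Int.units_eq_one_or b' with rfl | rfl <;>
  · simp [InQuad] at e1 e2 e3 ⊢
    try omega

theorem orthoConvex_cross : OrthoConvex (cross w h) := by
  intro p hp
  rw [mem_cross] at hp
  refine ⟨(if 0 ≤ p.1 then 1 else -1, if 0 ≤ p.2 then 1 else -1), fun y hy hq => ?_⟩
  rw [mem_cross] at hy
  unfold InQuad at hq
  split_ifs at hq <;> simp at hq <;> omega

theorem orthoConvex_empty : OrthoConvex ∅ := fun _ _ => ⟨1, by simp⟩

/-- The cell of the block `p + {0, 1}²` in the direction `s`. -/
def corner (s : ℤˣ × ℤˣ) (p : ℤ × ℤ) : ℤ × ℤ :=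
  (p.1 + if s.1 = 1 then 1 else 0, p.2 + if s.2 = 1 then 1 else 0)

theorem corner_injective (s : ℤˣ × ℤˣ) : Function.Injective (corner s) := by
  intro p q h
  simpa [corner, Prod.ext_iff] using h

/-- Inner corners of different directions have different cells. Inner cells must be bounded from
below, so overlaps have to be excluded; for outer cells an upper bound is enough. -/
theorem sign_eq_of_corner_eq (hoc : OrthoConvex B) {G : Finset (ℤ × ℤ)} {s s' : ℤˣ × ℤˣ}
    {q q' : ℤ × ℤ} (hq : q ∈ innerCorners s G B) (hq' : q' ∈ innerCorners s' G B)
    (h : corner s q = corner s' q') : s = s' := by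
  obtain ⟨-, h0, h1, h2⟩ := mem_innerCorners.1 hq'
  have e1 := not_inQuad_of_mem_innerCorners hoc hq h1
  have e2 := not_inQuad_of_mem_innerCorners hoc hq h2
  obtain ⟨a, b⟩ := s
  obtain ⟨a', b'⟩ := s'
  rcases Int.units_eq_one_or a with rfl | rfl <;> rcases Int.units_eq_one_or b with rfl | rfl <;>
  rcases Int.units_eq_one_or a' with rfl | rfl <;>
  rcases Int.units_eq_one_or b' with rfl | rfl <;>
  first
  | rfl
  | simp [InQuad, corner, Prod.ext_iff] at e1 e2 h; omega

end Cross

/-! ### Lower bound: the largest convex set of minus blocks -/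

section InnerShape

variable {L : ℕ} {w h : ℤ} {B M N : Finset (ℤ × ℤ)}

theorem corner_neg_fst (s : ℤˣ × ℤˣ) (b : ℤˣ) (q : ℤ × ℤ) :
    corner (-s.1, b) q = corner (s.1, b) (q.1 - s.1, q.2) := by
  rcases Int.units_eq_one_or s.1 with h | h <;> simp [corner, h]

theorem corner_neg_snd (s : ℤˣ × ℤˣ) (a : ℤˣ) (q : ℤ × ℤ) :
    corner (a, -s.2) q = corner (a, s.2) (q.1, q.2 - s.2) := by
  rcases Int.units_eq_one_or s.2 with h | h <;> simp [corner, h]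

theorem nbrSum_corner (σ : Config L) (s : ℤˣ × ℤˣ) (p : ℤ × ℤ) :
    nbrSum σ (corner s p) =
      (if corner (-s.1, s.2) p ∈ minusSet σ then -1 else 1) +
      (if corner (s.1, -s.2) p ∈ minusSet σ then -1 else 1) +
      (if corner s (p.1 + s.1, p.2) ∈ minusSet σ then -1 else 1) +
      (if corner s (p.1, p.2 + s.2) ∈ minusSet σ then -1 else 1) := by
  rw [nbrSum_eq]
  obtain ⟨a, b⟩ := s
  rcases Int.units_eq_one_or a with rfl | rfl <;> rcases Int.units_eq_one_or b with rfl | rfl <;>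
    simp [corner] <;> ring_nf

/-- `B` is an orthogonally convex set of positions in the cross of `2 × 2` blocks all of
whose cells are in `M`. -/
def IsInnerShape (w h : ℤ) (M B : Finset (ℤ × ℤ)) : Prop :=
  B ⊆ cross w h ∧ OrthoConvex B ∧ ∀ p ∈ B, ∀ s, corner s p ∈ M

open scoped Classical in
/-- The largest number of blocks of an inner shape of `M`. -/
noncomputable def innerArea (w h : ℤ) (M : Finset (ℤ × ℤ)) : ℕ :=
  ((cross w h).powerset.filter (IsInnerShape w h M)).sup Finset.card

theorem IsInnerShape.card_le_innerArea (hB : IsInnerShape w h M B) :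
    B.card ≤ innerArea w h M := by
  classical
  unfold innerArea
  exact Finset.le_sup (f := Finset.card)
    (Finset.mem_filter.2 ⟨Finset.mem_powerset.2 hB.1, hB⟩)

theorem exists_isInnerShape (w h : ℤ) (M : Finset (ℤ × ℤ)) :
    ∃ B, IsInnerShape w h M B ∧ B.card = innerArea w h M := by
  classical
  obtain ⟨B, hB, h'⟩ := Finset.exists_mem_eq_sup
    ((cross w h).powerset.filter (IsInnerShape w h M))
    ⟨∅, by simp [IsInnerShape, orthoConvex_empty]⟩ Finset.card
  refine ⟨B, (Finset.mem_filter.1 hB).2, h'.symm.trans ?_⟩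
  unfold innerArea
  congr!

theorem innerArea_mono (hMN : M ⊆ N) : innerArea w h M ≤ innerArea w h N := by
  obtain ⟨B, hB, h'⟩ := exists_isInnerShape w h M
  rw [← h']
  exact IsInnerShape.card_le_innerArea ⟨hB.1, hB.2.1, fun p hp s => hMN (hB.2.2 p hp s)⟩

/-- The cells whose removal spoils an inner shape. -/
noncomputable def outerCells (B : Finset (ℤ × ℤ)) : Finset (ℤ × ℤ) :=
  Finset.univ.biUnion fun s : ℤˣ × ℤˣ => (outerCorners s B).image (corner s)

/-- The cells whose addition enlarges an inner shape. -/
noncomputable def innerCells (G B : Finset (ℤ × ℤ)) : Finset (ℤ × ℤ) :=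
  Finset.univ.biUnion fun s : ℤˣ × ℤˣ => (innerCorners s G B).image (corner s)

theorem mem_outerCells {x : ℤ × ℤ} :
    x ∈ outerCells B ↔ ∃ s, ∃ p ∈ outerCorners s B, corner s p = x := by
  simp [outerCells]

theorem mem_innerCells {G : Finset (ℤ × ℤ)} {x : ℤ × ℤ} :
    x ∈ innerCells G B ↔ ∃ s, ∃ q ∈ innerCorners s G B, corner s q = x := by
  simp [innerCells]

theorem card_outerCells_le (B : Finset (ℤ × ℤ)) :
    (outerCells B).card ≤ ∑ s : ℤˣ × ℤˣ, (outerCorners s B).card :=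
  Finset.card_biUnion_le.trans (Finset.sum_le_sum fun _ _ => Finset.card_image_le)

theorem card_innerCells {G : Finset (ℤ × ℤ)} (hoc : OrthoConvex B) :
    (innerCells G B).card = ∑ s : ℤˣ × ℤˣ, (innerCorners s G B).card := by
  rw [innerCells, Finset.card_biUnion]
  · exact Finset.sum_congr rfl fun s _ => Finset.card_image_of_injective _ (corner_injective s)
  · intro s _ s' _ hs
    rw [Function.onFun, Finset.disjoint_left]
    intro x hx hx'
    obtain ⟨q, hq, rfl⟩ := Finset.mem_image.1 hx
    obtain ⟨q', hq', h'⟩ := Finset.mem_image.1 hx'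
    exact hs (sign_eq_of_corner_eq hoc hq hq' h'.symm)

theorem card_signs : (Finset.univ : Finset (ℤˣ × ℤˣ)).card = 4 := by
  simp [Fintype.card_prod]

theorem card_outerCells_le_card_innerCells (hoc : OrthoConvex B) (hm : MeetsArms w B)
    (hG : B ⊆ cross w h) : (outerCells B).card ≤ (innerCells (cross w h) B).card + 8 := by
  rw [card_innerCells hoc]
  refine (card_outerCells_le B).trans
    ((Finset.sum_le_sum fun s _ => card_outerCorners_le hoc hm hG s).trans ?_)
  rw [Finset.sum_add_distrib, Finset.sum_const, card_signs]
  simp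

theorem card_outerCells_le_width (hoc : OrthoConvex B) (hm : MeetsArms w B)
    (hG : B ⊆ cross w h) (hh : 0 ≤ h) : ((outerCells B).card : ℤ) ≤ 8 * h + 4 := by
  have h1 : ((outerCells B).card : ℤ) ≤ ∑ s : ℤˣ × ℤˣ, ((outerCorners s B).card : ℤ) := by
    exact_mod_cast card_outerCells_le B
  refine h1.trans
    ((Finset.sum_le_sum fun s _ => card_outerCorners_le_width hoc hm hG hh s).trans ?_)
  rw [Finset.sum_const, card_signs, nsmul_eq_mul]
  push_cast
  linarith

/-- The two neighbouring blocks that belong to `B` cover three of the four cells of the block at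
`q`; only the cell in direction `s` can be missing. -/
theorem corner_mem_of_mem_innerCorners (hB : IsInnerShape w h M B) {s s' : ℤˣ × ℤˣ}
    {q : ℤ × ℤ} (hq : q ∈ innerCorners s (cross w h) B) (hs : s' ≠ s) : corner s' q ∈ M := by
  obtain ⟨-, -, h1, h2⟩ := mem_innerCorners.1 hq
  obtain ⟨a', b'⟩ := s'
  by_cases ha : a' = s.1
  · have hb : b' = -s.2 := by
      refine Int.units_ne_iff_eq_neg.1 fun hb => hs (Prod.ext ha hb)
    rw [hb, corner_neg_snd]
    exact hB.2.2 _ h2 _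
  · rw [Int.units_ne_iff_eq_neg.1 ha, corner_neg_fst]
    exact hB.2.2 _ h1 _

theorem IsInnerShape.insert (hB : IsInnerShape w h M B) {s : ℤˣ × ℤˣ}
    {q : ℤ × ℤ} (hq : q ∈ innerCorners s (cross w h) B) (hMN : M ⊆ N) (hc : corner s q ∈ N) :
    IsInnerShape w h N (insert q B) := by
  refine ⟨Finset.insert_subset (mem_innerCorners.1 hq).1 hB.1, hB.2.1.insert hq, ?_⟩
  intro p hp s'
  rcases Finset.mem_insert.1 hp with rfl | hp
  · by_cases hs : s' = s
    · rwa [hs]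
    · exact hMN (corner_mem_of_mem_innerCorners hB hq hs)
  · exact hMN (hB.2.2 p hp s')

/-- Otherwise the block at `q` could be added, against the maximality of `B`. -/
theorem notMem_of_mem_innerCorners (hB : IsInnerShape w h M B)
    (hmax : B.card = innerArea w h M) {s : ℤˣ × ℤˣ}
    {q : ℤ × ℤ} (hq : q ∈ innerCorners s (cross w h) B) : corner s q ∉ M := by
  intro hc
  have := (hB.insert hq subset_rfl hc).card_le_innerArea
  rw [Finset.card_insert_of_notMem (mem_innerCorners.1 hq).2.1] at this
  omega

theorem innerArea_insert (hB : IsInnerShape w h M B)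
    (hmax : B.card = innerArea w h M) {s : ℤˣ × ℤˣ}
    {q : ℤ × ℤ} (hq : q ∈ innerCorners s (cross w h) B) :
    innerArea w h M + 1 ≤ innerArea w h (Insert.insert (corner s q) M) := by
  have := (hB.insert hq (Finset.subset_insert (corner s q) M)
    (Finset.mem_insert_self _ _)).card_le_innerArea
  rw [Finset.card_insert_of_notMem (mem_innerCorners.1 hq).2.1] at this
  omega

/-- A block that shares the extreme cell of `p` lies in the quadrant at `p` in direction `s`, where
`p` is the only point of `B`. So losing this cell destroys a single block. -/
theorem eq_of_corner_eq_of_mem_outerCorners (hoc : OrthoConvex B) (hm : MeetsArms w B)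
    (hG : B ⊆ cross w h) {s s' : ℤˣ × ℤˣ} {p p' : ℤ × ℤ} (hp : p ∈ outerCorners s B)
    (hp' : p' ∈ B) (hc : corner s' p' = corner s p) : p' = p := by
  refine eq_of_mem_outerCorners hoc hm hG hp hp' ?_
  obtain ⟨a, b⟩ := s
  obtain ⟨a', b'⟩ := s'
  rcases Int.units_eq_one_or a with rfl | rfl <;> rcases Int.units_eq_one_or b with rfl | rfl <;>
  rcases Int.units_eq_one_or a' with rfl | rfl <;>
  rcases Int.units_eq_one_or b' with rfl | rfl <;>
  · simp [InQuad, corner, Prod.ext_iff] at hc ⊢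
    omega

theorem innerArea_erase_outer (hB : IsInnerShape w h M B) (hm : MeetsArms w B)
    (hmax : B.card = innerArea w h M) {s : ℤˣ × ℤˣ} {p : ℤ × ℤ} (hp : p ∈ outerCorners s B) :
    innerArea w h M ≤ innerArea w h (M.erase (corner s p)) + 1 := by
  have h1 : IsInnerShape w h (M.erase (corner s p)) (B.erase p) := by
    refine ⟨(Finset.erase_subset _ _).trans hB.1, hB.2.1.erase hm hB.1 hp, ?_⟩
    intro p' hp' s'
    obtain ⟨hne, hp'B⟩ := Finset.mem_erase.1 hp'
    exact Finset.mem_erase.2 ⟨fun hc => hne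
      (eq_of_corner_eq_of_mem_outerCorners hB.2.1 hm hB.1 hp hp'B hc), hB.2.2 p' hp'B s'⟩
  have h2 := h1.card_le_innerArea
  rw [Finset.card_erase_of_mem (mem_outerCorners.1 hp).1] at h2
  omega

theorem innerArea_erase_of_forall (hB : IsInnerShape w h M B)
    (hmax : B.card = innerArea w h M) {x : ℤ × ℤ} (hx : ∀ p ∈ B, ∀ s, corner s p ≠ x) :
    innerArea w h M ≤ innerArea w h (M.erase x) := by
  rw [← hmax]
  exact IsInnerShape.card_le_innerArea
    ⟨hB.1, hB.2.1, fun p hp s => Finset.mem_erase.2 ⟨hx p hp s, hB.2.2 p hp s⟩⟩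

/-- The exponential of minus the area of the largest inner shape, truncated at one. -/
noncomputable def innerWeight (w h : ℤ) (θ a : ℝ) (σ : Config L) : ℝ :=
  min 1 (Real.exp (θ * (a - innerArea w h (minusSet σ))))

theorem innerWeight_nonneg (θ a : ℝ) (σ : Config L) : 0 ≤ innerWeight w h θ a σ :=
  le_min zero_le_one (Real.exp_pos _).le

theorem innerWeight_le_exp (θ a : ℝ) (σ : Config L) :
    innerWeight w h θ a σ ≤ Real.exp (θ * (a - innerArea w h (minusSet σ))) := min_le_right _ _

/-- Fix a maximal shape `B`. Only flips at its outer cells can raise the weight: they have rate at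
most 1/2 and cost at most one block, while any other cell of a block has at least three minus
neighbours. Flips at inner cells have rate at least 1/2 and gain a block. New minus sites elsewhere
do no harm, as `innerArea` is monotone. -/
theorem generator_innerWeight_le_of_card {θ a : ℝ} (hθ : 0 ≤ θ) (σ : Config L) (hh : 0 ≤ h)
    (hhL : h + 1 ≤ L) (hB : IsInnerShape w h (minusSet σ) B) (hm : MeetsArms w B)
    (hmax : B.card = innerArea w h (minusSet σ)) (ha : a ≤ innerArea w h (minusSet σ)) :
    generator L (innerWeight w h θ a) σ ≤
      (1 / 2) * (8 * L * (Real.exp θ + Real.exp (-θ) - 2) + 8 * (1 - Real.exp (-θ))) *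
        innerWeight w h θ a σ := by
  set M := minusSet σ with hM
  set n := innerArea w h M with hn
  have hv : innerWeight w h θ a σ = Real.exp (θ * (a - n)) := by
    refine min_eq_right (Real.exp_le_one_iff.2 (mul_nonpos_of_nonneg_of_nonpos hθ ?_))
    linarith
  set v := Real.exp (θ * (a - n)) with hvdef
  have hv0 : 0 < v := Real.exp_pos _
  have hem : Real.exp (-θ) ≤ 1 := Real.exp_le_one_iff.2 (by linarith)
  have hep : 1 ≤ Real.exp θ := Real.one_le_exp hθ
  have hw : ∀ (τ : Config L) (k : ℤ), (n : ℤ) ≤ innerArea w h (minusSet τ) + k →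
      innerWeight w h θ a τ ≤ v * Real.exp (θ * k) := by
    intro τ k h'
    refine (innerWeight_le_exp θ a τ).trans ?_
    rw [hvdef, ← Real.exp_add, Real.exp_le_exp, ← mul_add]
    have : (n : ℝ) ≤ innerArea w h (minusSet τ) + k := by exact_mod_cast h'
    exact mul_le_mul_of_nonneg_left (by linarith) hθ
  have hMb : M ⊆ box L := minusSet_subset σ
  have hOM : outerCells B ⊆ M := by
    intro x hx
    obtain ⟨s, p, hp, rfl⟩ := mem_outerCells.1 hx
    exact hB.2.2 p (mem_outerCorners.1 hp).1 s
  have hIM : ∀ x ∈ innerCells (cross w h) B, x ∉ M := by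
    intro x hx
    obtain ⟨s, q, hq, rfl⟩ := mem_innerCells.1 hx
    exact notMem_of_mem_innerCorners hB hmax hq
  have hIb : innerCells (cross w h) B ⊆ box L := by
    intro x hx
    obtain ⟨s, q, hq, rfl⟩ := mem_innerCells.1 hx
    have hqG := mem_cross.1 (mem_innerCorners.1 hq).1
    rw [mem_box]
    simp only [corner]
    split_ifs <;> omega
  have hbound := generator_le (f := innerWeight w h θ a) (σ := σ)
    (fun x => (if x ∈ outerCells B then (1 / 2) * v * (Real.exp θ - 1) else 0) +
      (if x ∈ innerCells (cross w h) B then (1 / 2) * v * (Real.exp (-θ) - 1) else 0)) ?_ ?_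
  · rw [Finset.sum_add_distrib, ← Finset.sum_filter, ← Finset.sum_filter,
      Finset.sum_const, Finset.sum_const] at hbound
    have e1 : (box L).filter (· ∈ outerCells B) = outerCells B := by
      rw [Finset.filter_mem_eq_inter, Finset.inter_eq_right]
      exact hOM.trans hMb
    have e2 : (box L).filter (· ∈ innerCells (cross w h) B) = innerCells (cross w h) B := by
      rw [Finset.filter_mem_eq_inter, Finset.inter_eq_right]
      exact hIb
    rw [e1, e2, nsmul_eq_mul, nsmul_eq_mul] at hbound
    refine hbound.trans ?_
    have h1 : ((outerCells B).card : ℝ) ≤ (innerCells (cross w h) B).card + 8 := by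
      exact_mod_cast card_outerCells_le_card_innerCells hB.2.1 hm hB.1
    have h2 : ((outerCells B).card : ℝ) ≤ 8 * L := by
      have h2 := card_outerCells_le_width hB.2.1 hm hB.1 hh
      have h2' : ((outerCells B).card : ℤ) ≤ 8 * L := by omega
      exact_mod_cast h2'
    have h3 : 0 ≤ Real.exp θ + Real.exp (-θ) - 2 := by
      have := Real.add_one_le_exp θ
      have := Real.add_one_le_exp (-θ)
      linarith
    rw [hv]
    set r : ℝ := ((outerCells B).card : ℝ)
    set z : ℝ := ((innerCells (cross w h) B).card : ℝ)
    have key : r * (Real.exp θ - 1) + z * (Real.exp (-θ) - 1) ≤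
        8 * L * (Real.exp θ + Real.exp (-θ) - 2) + 8 * (1 - Real.exp (-θ)) := by
      -- The factor is negative, so the lower bound `z ≥ r - 8` on the number of inner cells is the
      -- useful one.
      have h4 : z * (Real.exp (-θ) - 1) ≤ (r - 8) * (Real.exp (-θ) - 1) :=
        mul_le_mul_of_nonpos_right (by linarith) (by linarith)
      have h5 := mul_le_mul_of_nonneg_right h2 h3
      linarith
    have := mul_le_mul_of_nonneg_left key (show 0 ≤ 1 / 2 * v by positivity)
    linarith
  · intro x hx
    rw [if_neg fun h' => hIM _ h' hx, add_zero, hv]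
    have hupd : minusSet (Function.update σ x 1) = M.erase x := by
      rw [minusSet_update, if_neg (by decide)]
    split_ifs with hout
    · obtain ⟨s, p, hp, hpx⟩ := mem_outerCells.1 hout
      have h1 : innerWeight w h θ a (Function.update σ x 1) ≤ v * Real.exp θ := by
        have := hw (Function.update σ x 1) 1 (by
          rw [hupd, ← hpx]
          exact_mod_cast innerArea_erase_outer hB hm hmax hp)
        simpa using this
      have h2 : heatBath σ x 1 ≤ 1 / 2 := by
        have hpB := (mem_outerCorners.1 hp).1
        have hS := nbrSum_corner σ s p
        rw [if_pos (hB.2.2 p hpB _), if_pos (hB.2.2 p hpB _), hpx] at hS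
        have : nbrSum σ x ≤ 0 := by rw [hS]; split_ifs <;> norm_num
        rw [heatBath_one]
        split_ifs <;> first | omega | norm_num
      calc _ ≤ heatBath σ x 1 * (v * (Real.exp θ - 1)) :=
            mul_le_mul_of_nonneg_left (by linarith) (heatBath_nonneg _ _ _)
        _ ≤ 1 / 2 * (v * (Real.exp θ - 1)) :=
            mul_le_mul_of_nonneg_right h2 (mul_nonneg hv0.le (by linarith))
        _ = _ := by ring
    · by_cases hcov : ∃ p ∈ B, ∃ s, corner s p = x
      · obtain ⟨p, hpB, s, hpx⟩ := hcov
        have hS := nbrSum_corner σ s p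
        rw [if_pos (hB.2.2 p hpB _), if_pos (hB.2.2 p hpB _), hpx] at hS
        have hneg : nbrSum σ x < 0 := by
          by_cases h1 : corner s (p.1 + s.1, p.2) ∈ M
          · rw [if_pos h1] at hS; rw [hS]; split_ifs <;> norm_num
          · by_cases h2 : corner s (p.1, p.2 + s.2) ∈ M
            · rw [if_pos h2] at hS; rw [hS]; split_ifs <;> norm_num
            · exact absurd (mem_outerCells.2 ⟨s, p, mem_outerCorners.2
                ⟨hpB, fun h => h1 (hB.2.2 _ h _), fun h => h2 (hB.2.2 _ h _)⟩, hpx⟩) hout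
        rw [heatBath_one, if_neg hneg.ne, if_neg hneg.not_gt, zero_mul]
      · push Not at hcov
        have := hw (Function.update σ x 1) 0 (by
          rw [hupd]
          exact_mod_cast innerArea_erase_of_forall hB hmax hcov)
        exact mul_nonpos_of_nonneg_of_nonpos (heatBath_nonneg _ _ _) (by simpa using this)
  · intro x hx
    rw [if_neg fun h' => hx (hOM h'), zero_add, hv]
    have hupd : minusSet (Function.update σ x (-1)) = insert (x : ℤ × ℤ) M := by
      rw [minusSet_update, if_pos rfl]
    split_ifs with hin
    · obtain ⟨s, q, hq, hqx⟩ := mem_innerCells.1 hin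
      have h1 : innerWeight w h θ a (Function.update σ x (-1)) ≤ v * Real.exp (-θ) := by
        have := hw (Function.update σ x (-1)) (-1) (by
          rw [hupd, ← hqx]
          have := innerArea_insert hB hmax hq
          omega)
        simpa using this
      have h2 : 1 / 2 ≤ heatBath σ x (-1) := by
        have hS := nbrSum_corner σ s q
        rw [if_pos (corner_mem_of_mem_innerCorners hB hq (by
            simp [Prod.ext_iff, units_ne_neg_self, eq_comm])),
          if_pos (corner_mem_of_mem_innerCorners hB hq (by
            simp [Prod.ext_iff, units_ne_neg_self, eq_comm])), hqx] at hS
        have : nbrSum σ x ≤ 0 := by rw [hS]; split_ifs <;> norm_num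
        rw [heatBath_neg_one]
        split_ifs <;> first | omega | norm_num
      have h4 : v * (Real.exp (-θ) - 1) ≤ 0 :=
        mul_nonpos_of_nonneg_of_nonpos hv0.le (by linarith)
      calc _ ≤ heatBath σ x (-1) * (v * (Real.exp (-θ) - 1)) :=
            mul_le_mul_of_nonneg_left (by linarith) (heatBath_nonneg _ _ _)
        _ ≤ 1 / 2 * (v * (Real.exp (-θ) - 1)) := mul_le_mul_of_nonpos_right h2 h4
        _ = _ := by ring
    · have := hw (Function.update σ x (-1)) 0 (by
        rw [hupd]
        exact_mod_cast innerArea_mono (Finset.subset_insert _ _))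
      exact mul_nonpos_of_nonneg_of_nonpos (heatBath_nonneg _ _ _) (by simpa using this)

/-- Above the threshold area the shape meets all the half arms and the corner count applies. At or
below it the truncated weight has its maximal value 1, so the generator is nonpositive there. -/
theorem generator_innerWeight_le {θ : ℝ} (hθ : 0 ≤ θ) (σ : Config L) (hw : 0 ≤ w) (hwh : w ≤ h)
    (hhL : h + 1 ≤ L) :
    generator L (innerWeight w h θ ((cross w h).card - w * (h - w))) σ ≤
      (1 / 2) * (8 * L * (Real.exp θ + Real.exp (-θ) - 2) + 8 * (1 - Real.exp (-θ))) *
        innerWeight w h θ ((cross w h).card - w * (h - w)) σ := by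
  set a : ℝ := (cross w h).card - w * (h - w) with ha
  obtain ⟨B, hB, hmax⟩ := exists_isInnerShape w h (minusSet σ)
  by_cases hlt : a < innerArea w h (minusSet σ)
  · refine generator_innerWeight_le_of_card hθ σ (hw.trans hwh) hhL hB ?_ hmax hlt.le
    refine meetsArms_of_card hw hwh ?_
    have h1 := Finset.card_sdiff_add_card_eq_card hB.1
    rw [← hmax, ha] at hlt
    have h2 : ((cross w h).card : ℤ) - w * (h - w) < B.card := by exact_mod_cast hlt
    omega
  · have h1 : innerWeight w h θ a σ = 1 := by
      refine min_eq_left (Real.one_le_exp (mul_nonneg hθ ?_))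
      linarith
    have h2 : ∀ τ : Config L, innerWeight w h θ a τ ≤ 1 := fun τ => min_le_left _ _
    have h3 : 0 ≤ Real.exp θ + Real.exp (-θ) - 2 := by
      have := Real.add_one_le_exp θ
      have := Real.add_one_le_exp (-θ)
      linarith
    have h4 : Real.exp (-θ) ≤ 1 := Real.exp_le_one_iff.2 (by linarith)
    refine le_trans (generator_le (fun _ => 0) ?_ ?_) ?_
    · exact fun x _ => mul_nonpos_of_nonneg_of_nonpos (heatBath_nonneg _ _ _)
        (by linarith [h2 (Function.update σ x 1)])
    · exact fun x _ => mul_nonpos_of_nonneg_of_nonpos (heatBath_nonneg _ _ _)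
        (by linarith [h2 (Function.update σ x (-1))])
    · rw [Finset.sum_const_zero, h1]
      have : 0 ≤ 1 - Real.exp (-θ) := by linarith
      positivity

theorem innerArea_box (hhL : h + 1 ≤ L) :
    (cross w h).card ≤ innerArea w h (box L) := by
  refine IsInnerShape.card_le_innerArea ⟨subset_rfl, orthoConvex_cross, fun p hp s => ?_⟩
  rw [mem_cross] at hp
  rw [mem_box]
  simp only [corner]
  split_ifs <;> omega

theorem innerWeight_plus {θ : ℝ} (hθ : 0 ≤ θ) {a : ℝ} (ha : 0 ≤ a) :
    1 ≤ innerWeight w h θ a (fun _ => 1 : Config L) := by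
  have h0 : innerArea w h (minusSet (fun _ => 1 : Config L)) = 0 := by
    obtain ⟨B, hB, hmax⟩ := exists_isInnerShape w h (minusSet (fun _ => 1 : Config L))
    rw [← hmax, Finset.card_eq_zero, Finset.eq_empty_iff_forall_notMem]
    intro p hp
    have := hB.2.2 p hp 1
    rw [minusSet_eq_empty.2 fun _ => rfl] at this
    simp at this
  refine le_min le_rfl (Real.one_le_exp ?_)
  rw [h0]
  simpa using mul_nonneg hθ ha

end InnerShape

/-! ### Transition probabilities to all plus, and the hitting time -/

section HittingTime

variable {L : ℕ}

theorem transition_plus_le_of_large {K : ℝ} (hK : K = 4 * 27 ^ 2 * Real.exp 27 + 108)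
    (hL : 3 ≤ L) {t : ℝ} (ht0 : 0 ≤ t) (ht : t * K ≤ (L : ℝ) ^ 2) :
    transition L t (fun _ => -1) (fun _ => 1) ≤ Real.exp (-(2 * L)) := by
  have hL' : (3 : ℝ) ≤ L := by exact_mod_cast hL
  obtain ⟨w, hw0, hw1, hw2⟩ : ∃ w : ℤ, 0 ≤ w ∧ w ≤ (L : ℤ) - 1 ∧
      (L : ℤ) ^ 2 ≤ 9 * (w * ((L : ℤ) - 1 - w)) := by
    -- This width nearly maximizes the area `w (h - w)` of a half arm for `h = L - 1`. The constant
    -- 9 is attained at `L = 3`.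
    refine ⟨((L : ℤ) - 1) / 2, by omega, by omega, ?_⟩
    obtain ⟨k, hk | hk⟩ := Int.even_or_odd' ((L : ℤ) - 1)
    · have h1 : ((L : ℤ) - 1) / 2 = k := by omega
      have h2 : (L : ℤ) = 2 * k + 1 := by omega
      rw [h1, h2]
      nlinarith [show (1 : ℤ) ≤ k by omega]
    · have h1 : ((L : ℤ) - 1) / 2 = k := by omega
      have h2 : (L : ℤ) = 2 * k + 2 := by omega
      rw [h1, h2]
      nlinarith [show (1 : ℤ) ≤ k by omega]
  set h : ℤ := (L : ℤ) - 1 with hh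
  -- The initial exponent is at most `-θ L²/9 = -3L`, which leaves `-2L` after a growth by at most
  -- `L`.
  set θ : ℝ := 27 / L with hθ
  have hθ0 : 0 < θ := by positivity
  have hθL : θ * L = 27 := by rw [hθ]; field_simp
  have hθ27 : θ ≤ 27 := by nlinarith
  set a : ℝ := (cross w h).card - w * (h - w) with ha
  have ha0 : 0 ≤ a := by
    by_contra hcon
    have h1 : ((cross w h).card : ℤ) < w * (h - w) := by
      have : ((cross w h).card : ℝ) < w * (h - w) := by linarith
      exact_mod_cast this
    have := (meetsArms_of_card (B := ∅) hw0 hw1 (by simpa using h1) 1).1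
    simp at this
  have hN : (L : ℝ) ^ 2 ≤ 9 * (w * (h - w)) := by exact_mod_cast hw2
  have hrate : (1 / 2) * (8 * L * (Real.exp θ + Real.exp (-θ) - 2) + 8 * (1 - Real.exp (-θ))) ≤
      K / L := by
    have e1 : 1 - Real.exp (-θ) ≤ θ := by linarith [Real.add_one_le_exp (-θ)]
    have e1' : 0 ≤ 1 - Real.exp (-θ) := by
      linarith [Real.exp_le_one_iff.2 (show -θ ≤ 0 by linarith)]
    have e2 : Real.exp θ * Real.exp (-θ) = 1 := by rw [← Real.exp_add]; simp
    have e3 : Real.exp θ + Real.exp (-θ) - 2 = Real.exp θ * (1 - Real.exp (-θ)) ^ 2 := by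
      linear_combination (2 - Real.exp (-θ)) * e2
    have e4 : (1 - Real.exp (-θ)) ^ 2 ≤ θ ^ 2 := pow_le_pow_left₀ e1' e1 2
    have e5 : Real.exp θ ≤ Real.exp 27 := Real.exp_le_exp.2 hθ27
    have e6 : Real.exp θ * (1 - Real.exp (-θ)) ^ 2 ≤ Real.exp 27 * θ ^ 2 :=
      mul_le_mul e5 e4 (sq_nonneg _) (Real.exp_pos _).le
    rw [e3, le_div_iff₀ (by linarith), hK]
    have e7 : (L : ℝ) * (L * (Real.exp θ * (1 - Real.exp (-θ)) ^ 2)) ≤ 27 ^ 2 * Real.exp 27 := by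
      calc _ ≤ (L : ℝ) * (L * (Real.exp 27 * θ ^ 2)) := by gcongr
        _ = (θ * L) ^ 2 * Real.exp 27 := by ring
        _ = _ := by rw [hθL]
    have e8 : (1 - Real.exp (-θ)) * L ≤ 27 := by
      rw [← hθL]; exact mul_le_mul_of_nonneg_right e1 (by linarith)
    linarith
  have hgen : ∀ σ : Config L, generator L (innerWeight w h θ a) σ ≤
      K / L * innerWeight w h θ a σ := fun σ =>
    (generator_innerWeight_le hθ0.le σ hw0 hw1 (by omega)).trans
      (mul_le_mul_of_nonneg_right hrate (innerWeight_nonneg _ _ _))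
  have hmain := sum_transition_le hgen (innerWeight_nonneg _ _)
    (S := {fun _ => 1}) (by
      intro σ hσ
      rw [Finset.mem_singleton.1 hσ]
      exact innerWeight_plus hθ0.le ha0) ht0 (fun _ => -1)
  rw [Finset.sum_singleton] at hmain
  refine hmain.trans ((mul_le_mul_of_nonneg_left (innerWeight_le_exp _ _ _)
    (Real.exp_pos _).le).trans ?_)
  rw [← Real.exp_add, Real.exp_le_exp, minusSet_all]
  have h1 : ((cross w h).card : ℝ) ≤ innerArea w h (box L) := by
    exact_mod_cast innerArea_box (by omega)
  have h2 : K / L * t ≤ L := by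
    rw [div_mul_eq_mul_div, div_le_iff₀ (by linarith)]
    linarith
  have h3 : θ * (a - innerArea w h (box L)) ≤ -(3 * L) := by
    have h4 : θ * (a - innerArea w h (box L)) ≤ θ * (-(L ^ 2 / 9)) :=
      mul_le_mul_of_nonneg_left (by linarith) hθ0.le
    have h5 : θ * (-((L : ℝ) ^ 2 / 9)) = -(θ * L * L / 9) := by ring
    rw [h5, hθL] at h4
    linarith
  linarith

/-- The cross argument needs `L ≥ 3`. For smaller boxes it is enough that all minus is left at a
rate at most 25, the largest number of sites. -/
theorem transition_plus_le_of_small (hL : 1 ≤ L) (hL2 : L ≤ 2) {t : ℝ} (ht0 : 0 ≤ t)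
    (ht : t * (50 * Real.exp 6) ≤ (L : ℝ) ^ 2) :
    transition L t (fun _ => -1) (fun _ => 1) ≤ Real.exp (-(2 * L)) := by
  have hL' : (1 : ℝ) ≤ L := by exact_mod_cast hL
  have hL2' : (L : ℝ) ≤ 2 := by exact_mod_cast hL2
  have hne : (fun _ => 1 : Config L) ≠ fun _ => -1 := by
    intro h
    have := congrFun h ⟨(0, 0), by simp [mem_box]⟩
    exact absurd this (by decide)
  set f : Config L → ℝ := fun σ => if σ = fun _ => -1 then Real.exp (-(3 * L)) else 1 with hf
  have hf1 : ∀ σ, f σ ≤ 1 := by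
    intro σ
    simp only [hf]
    split_ifs
    · exact Real.exp_le_one_iff.2 (by linarith)
    · exact le_rfl
  have hf0 : ∀ σ, 0 ≤ f σ := by
    intro σ
    simp only [hf]
    split_ifs <;> positivity
  have hhb : ∀ (σ : Config L) x s, heatBath σ x s ≤ 1 := by
    intro σ x s
    have := sum_heatBath σ x
    have h1 := heatBath_nonneg σ x 1
    have h2 := heatBath_nonneg σ x (-1)
    rcases Int.units_eq_one_or s with rfl | rfl <;> linarith
  have hgen : ∀ σ, generator L f σ ≤ 25 * Real.exp 6 * f σ := by
    intro σ
    by_cases hσ : σ = fun _ => -1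
    · have h1 : generator L f σ ≤ ∑ x ∈ box L, (1 : ℝ) :=
        generator_le (fun _ => 1)
          (fun x _ => by
            nlinarith [hhb σ x 1, heatBath_nonneg σ x 1, hf1 (Function.update σ x 1), hf0 σ])
          (fun x _ => by
            nlinarith [hhb σ x (-1), heatBath_nonneg σ x (-1), hf1 (Function.update σ x (-1)),
              hf0 σ])
      rw [Finset.sum_const, card_box, nsmul_eq_mul, mul_one] at h1
      push_cast at h1
      have h2 : f σ = Real.exp (-(3 * L)) := if_pos hσ
      have h3 : 1 ≤ Real.exp 6 * f σ := by
        rw [h2, ← Real.exp_add]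
        exact Real.one_le_exp (by linarith)
      nlinarith
    · have h2 : f σ = 1 := if_neg hσ
      refine (generator_le (fun _ => 0) ?_ ?_).trans ?_
      · exact fun x _ => mul_nonpos_of_nonneg_of_nonpos (heatBath_nonneg _ _ _)
          (by linarith [hf1 (Function.update σ x 1)])
      · exact fun x _ => mul_nonpos_of_nonneg_of_nonpos (heatBath_nonneg _ _ _)
          (by linarith [hf1 (Function.update σ x (-1))])
      · rw [Finset.sum_const_zero, h2]
        positivity
  have h := sum_transition_le hgen hf0 (S := {fun _ => 1}) (fun τ hτ => by
    rw [Finset.mem_singleton.1 hτ]; exact (if_neg hne).ge) ht0 (fun _ => -1)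
  have h2 : f (fun _ => -1) = Real.exp (-(3 * L)) := if_pos rfl
  rw [Finset.sum_singleton, h2, ← Real.exp_add] at h
  refine h.trans (Real.exp_le_exp.2 ?_)
  nlinarith

/-- Under plus boundary conditions no site of the all-plus state can flip, so the indicator of its
complement satisfies Gronwall with rate 0 and vanishes at the starting point. -/
theorem transition_plus_eq_zero {t : ℝ} (ht : 0 ≤ t) {σ : Config L} (hσ : σ ≠ fun _ => 1) :
    transition L t (fun _ => 1) σ = 0 := by
  set f : Config L → ℝ := fun σ => if σ = fun _ => 1 then 0 else 1 with hf
  have hf1 : ∀ σ, f σ ≤ 1 := by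
    intro σ
    simp only [hf]
    split_ifs <;> norm_num
  have hgen : ∀ σ, generator L f σ ≤ 0 * f σ := by
    intro τ
    rw [zero_mul]
    refine (generator_le (fun _ => 0) ?_ ?_).trans (by simp)
    · intro x hx
      have h1 : τ ≠ fun _ => 1 := by
        rintro rfl
        rw [minusSet_eq_empty.2 fun _ => rfl] at hx
        simp at hx
      have h2 : f τ = 1 := if_neg h1
      exact mul_nonpos_of_nonneg_of_nonpos (heatBath_nonneg _ _ _)
        (by rw [h2]; linarith [hf1 (Function.update τ x 1)])
    · intro x hx
      by_cases h1 : τ = fun _ => 1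
      · have hpos : 0 < nbrSum τ x := by
          rw [nbrSum_eq, minusSet_eq_empty.2 (fun x => congrFun h1 x)]; simp
        rw [heatBath_neg_one, if_neg hpos.ne', if_pos hpos, zero_mul]
      · have h2 : f τ = 1 := if_neg h1
        exact mul_nonpos_of_nonneg_of_nonpos (heatBath_nonneg _ _ _)
          (by rw [h2]; linarith [hf1 (Function.update τ x (-1))])
  have h := sum_transition_le hgen (fun σ => by simp only [hf]; split_ifs <;> norm_num)
    (S := {σ}) (fun τ hτ => by
      rw [Finset.mem_singleton.1 hτ]; exact (if_neg hσ).ge) ht (fun _ => 1)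
  rw [Finset.sum_singleton] at h
  have h2 : f (fun _ => 1) = 0 := if_pos rfl
  rw [h2, mul_zero] at h
  exact le_antisymm h (transition_nonneg ht _ _)

variable {Ω : Type*} [MeasurableSpace Ω] {μ : Measure Ω} {ξ : Config L}
  {X : ℝ≥0 → Ω → Config L}

theorem IsGlauberDynamics.real_eq (hX : IsGlauberDynamics μ L ξ X) (T : ℝ≥0) (σ : Config L) :
    μ.real {ω | X T ω = σ} = transition L T ξ σ := by
  have h := hX.finite_dimensional 1 (fun i => if i = 0 then 0 else T)
    (fun i => if i = 0 then ξ else σ) (by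
      intro i j hij
      simp only
      split_ifs
      · exact le_rfl
      · exact zero_le
      · omega
      · exact le_rfl) rfl rfl
  simp only [Finset.range_one, Finset.prod_singleton] at h
  simp only [zero_add, one_ne_zero, if_true, if_false, NNReal.coe_zero, sub_zero] at h
  rw [← h]
  refine measureReal_congr ?_
  filter_upwards [hX.initial] with ω hω
  refine propext ⟨fun (h : X T ω = σ) i hi => ?_, fun h =>
    show X T ω = σ by simpa using h 1 le_rfl⟩
  interval_cases i
  · simpa using hω
  · simpa using h

theorem IsGlauberDynamics.real_pair_eq (hX : IsGlauberDynamics μ L ξ X) {s T : ℝ≥0} (hsT : s ≤ T)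
    (η σ : Config L) :
    μ.real {ω | X s ω = η ∧ X T ω = σ} =
      transition L s ξ η * transition L ((T : ℝ) - s) η σ := by
  have h := hX.finite_dimensional 2 (fun i => if i = 0 then 0 else if i = 1 then s else T)
    (fun i => if i = 0 then ξ else if i = 1 then η else σ) (by
      intro i j hij
      simp only
      split_ifs <;> first | omega | exact le_rfl | exact zero_le) rfl rfl
  simp only [Finset.prod_range_succ, Finset.prod_range_zero] at h
  norm_num at h
  rw [← h]
  refine measureReal_congr ?_
  filter_upwards [hX.initial] with ω hω
  refine propext ⟨fun (h : X s ω = η ∧ X T ω = σ) i hi => ?_, fun h =>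
    show X s ω = η ∧ X T ω = σ from ⟨by simpa using h 1 (by norm_num), by simpa using h 2 le_rfl⟩⟩
  interval_cases i
  · simpa using hω
  · simpa using h.1
  · simpa using h.2

variable [IsProbabilityMeasure μ]

/-- The all-plus configuration is absorbing. -/
theorem IsGlauberDynamics.ae_absorbing (hX : IsGlauberDynamics μ L ξ X) (T : ℝ≥0) :
    ∀ᵐ ω ∂μ, ∀ t < T, X t ω = (fun _ => 1) → X T ω = fun _ => 1 := by
  have h1 : ∀ᵐ ω ∂μ, ∀ q : ℚ, ∀ σ : Config L, Real.toNNReal q ≤ T → σ ≠ (fun _ => 1) →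
      ¬ (X (Real.toNNReal q) ω = (fun _ => 1) ∧ X T ω = σ) := by
    rw [ae_all_iff]
    intro q
    rw [ae_all_iff]
    intro σ
    by_cases hq : Real.toNNReal q ≤ T
    · by_cases hσ : σ = fun _ => 1
      · exact ae_of_all _ fun _ _ h => absurd hσ h
      · have h2 := hX.real_pair_eq hq (fun _ => 1) σ
        rw [transition_plus_eq_zero (sub_nonneg.2 (NNReal.coe_le_coe.2 hq)) hσ, mul_zero, measureReal_eq_zero_iff] at h2
        filter_upwards [measure_eq_zero_iff_ae_notMem.1 h2] with ω hω _ _ using hω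
    · exact ae_of_all _ fun _ h => absurd h hq
  filter_upwards [h1, hX.right_continuous] with ω hω hrc t ht hplus
  -- By right-continuity a visit to all plus at time `t` is still seen at a rational time in `(t,
  -- T)`, and the null sets of countably many rational times have been discarded.
  obtain ⟨u, htu, hu⟩ := (mem_nhdsGT_iff_exists_Ioo_subset).1 (hrc t)
  obtain ⟨q, -, hq1, hq2⟩ := (NNReal.lt_iff_exists_rat_btwn t (min u T)).1 (lt_min htu ht)
  have h2 : X (Real.toNNReal q) ω = fun _ => 1 :=
    (hu ⟨hq1, hq2.trans_le (min_le_left _ _)⟩).trans hplus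
  by_contra hcon
  exact hω q (X T ω) (hq2.le.trans (min_le_right _ _)) hcon ⟨h2, rfl⟩

/-- If the state is not all plus at time `T₁`, then by absorption it was not all plus before. If it
is all plus at time `T₂ > 0`, the infimum is at most `T₂`. -/
theorem IsGlauberDynamics.real_tauPlus_ge (hX : IsGlauberDynamics μ L ξ X) {T₁ T₂ : ℝ≥0}
    (hT₂ : 0 < T₂) :
    1 - transition L T₁ ξ (fun _ => 1) -
        ∑ σ ∈ Finset.univ.erase (fun _ => 1 : Config L), transition L T₂ ξ σ ≤
      μ.real {ω | (T₁ : ℝ≥0∞) ≤ tauPlus X ω ∧ tauPlus X ω ≤ T₂} := by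
  set E := {ω | (T₁ : ℝ≥0∞) ≤ tauPlus X ω ∧ tauPlus X ω ≤ T₂} with hE
  set A := {ω | X T₁ ω = fun _ => 1} with hA
  set C := ⋃ σ ∈ Finset.univ.erase (fun _ => 1 : Config L), {ω | X T₂ ω = σ} with hC
  have hA' : μ.real A = transition L T₁ ξ (fun _ => 1) := hX.real_eq _ _
  have hC' : μ.real C ≤ ∑ σ ∈ Finset.univ.erase (fun _ => 1 : Config L), transition L T₂ ξ σ := by
    refine (measureReal_biUnion_finset_le _ _).trans (Finset.sum_le_sum fun σ _ => ?_)
    exact (hX.real_eq _ _).le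
  have hcov : (Set.univ : Set Ω) ≤ᵐ[μ] (E ∪ (A ∪ C) : Set Ω) := by
    filter_upwards [hX.ae_absorbing T₁] with ω hω _
    by_cases h1 : X T₁ ω = fun _ => 1
    · exact Or.inr (Or.inl h1)
    by_cases h2 : X T₂ ω = fun _ => 1
    · refine Or.inl ⟨le_sInf ?_, sInf_le ⟨T₂, hT₂, fun x => congrFun h2 x, rfl⟩⟩
      rintro _ ⟨t, -, ht, rfl⟩
      rw [ENNReal.coe_le_coe]
      by_contra hlt
      exact h1 (hω t (not_le.1 hlt) (funext ht))
    · refine Or.inr (Or.inr (Set.mem_biUnion (x := X T₂ ω) ?_ rfl))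
      exact Finset.mem_coe.2 (Finset.mem_erase.2 ⟨h2, Finset.mem_univ _⟩)
  have h1 : μ.real Set.univ ≤ μ.real (E ∪ (A ∪ C)) :=
    ENNReal.toReal_mono (measure_ne_top _ _) (measure_mono_ae hcov)
  have h2 := measureReal_union_le (μ := μ) E (A ∪ C)
  have h3 := measureReal_union_le (μ := μ) A C
  rw [probReal_univ] at h1
  linarith

end HittingTime

end ZeroTempGlauber

theorem theorem3p3 :
    ∃ c γ : ℝ, 0 < c ∧ 0 < γ ∧
      ∀ (L : ℕ), 1 ≤ L →
      ∀ (Ω : Type*) [MeasurableSpace Ω] (μ : MeasureTheory.Measure Ω)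
        [MeasureTheory.IsProbabilityMeasure μ]
        (X : NNReal → Ω → ZeroTempGlauber.Config L),
        ZeroTempGlauber.IsGlauberDynamics μ L (fun _ => -1) X →
        1 - Real.exp (-γ * L) ≤
          μ.real {ω | ENNReal.ofReal (c * (L : ℝ) ^ 2) ≤ ZeroTempGlauber.tauPlus X ω ∧
            ZeroTempGlauber.tauPlus X ω ≤ ENNReal.ofReal ((1 / c) * (L : ℝ) ^ 2)} := by
  open ZeroTempGlauber in
  obtain ⟨K, hK⟩ : ∃ K, K = 4 * 27 ^ 2 * Real.exp 27 + 108 := ⟨_, rfl⟩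
  have hK0 : 108 ≤ K := by rw [hK]; have := Real.exp_pos 27; linarith
  set D : ℝ := K + 50 * Real.exp 6 + 12 with hD
  have he6 := Real.exp_pos 6
  have hD0 : 120 ≤ D := by linarith
  -- `D` dominates the constants `K` and `50 exp 6` of the two lower bounds, and the 120 of the
  -- upper bound since `K ≥ 108`.
  refine ⟨1 / D, 1, by positivity, one_pos, fun L hL Ω _ μ _ X hX => ?_⟩
  have hL' : (1 : ℝ) ≤ L := by exact_mod_cast hL
  have hT1 : 0 ≤ 1 / D * (L : ℝ) ^ 2 := by positivity
  have hDT : 1 / D * (L : ℝ) ^ 2 * D = (L : ℝ) ^ 2 := by field_simp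
  have hT2 : 120 * (L : ℝ) ^ 2 ≤ 1 / (1 / D) * (L : ℝ) ^ 2 := by
    rw [one_div_one_div]
    exact mul_le_mul_of_nonneg_right hD0 (by positivity)
  have h1 : transition L (1 / D * (L : ℝ) ^ 2) (fun _ => -1) (fun _ => 1) ≤
      Real.exp (-(2 * L)) := by
    by_cases h3 : 3 ≤ L
    · exact transition_plus_le_of_large hK h3 hT1
        ((mul_le_mul_of_nonneg_left (by linarith) hT1).trans hDT.le)
    · exact transition_plus_le_of_small hL (by omega) hT1
        ((mul_le_mul_of_nonneg_left (by linarith) hT1).trans hDT.le)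
  have h2 := sum_transition_ne_plus_le hL hT2
  have hT2' : 0 ≤ 1 / (1 / D) * (L : ℝ) ^ 2 := le_trans (by positivity) hT2
  have hmain := hX.real_tauPlus_ge (T₁ := Real.toNNReal (1 / D * (L : ℝ) ^ 2))
    (T₂ := Real.toNNReal (1 / (1 / D) * (L : ℝ) ^ 2))
    (Real.toNNReal_pos.2 (lt_of_lt_of_le (by positivity) hT2))
  rw [Real.coe_toNNReal _ hT1, Real.coe_toNNReal _ hT2'] at hmain
  refine le_trans ?_ hmain
  -- Each of the two bad events has probability at most `exp (-2L)`, and the factor 2 is absorbed by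
  -- `exp L ≥ L + 1 ≥ 2`.
  have h3 : 2 * Real.exp (-(2 * (L : ℝ))) ≤ Real.exp (-1 * L) := by
    have h4 : (2 : ℝ) ≤ Real.exp L := by linarith [Real.add_one_le_exp (L : ℝ)]
    have h5 : Real.exp (-1 * (L : ℝ)) = Real.exp L * Real.exp (-(2 * L)) := by
      rw [← Real.exp_add]; congr 1; ring
    rw [h5]
    exact mul_le_mul_of_nonneg_right h4 (Real.exp_pos _).le
  linarith
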